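/- Let $\mathcal H$ be the Hilbert space of one bosonic mode, with Fock basis $(|n\rangle)_{n\ge 0}$, annihilation operator $a$ and creation operator $a^\dagger$ ($a|n\rangle=\sqrt n\,|n-1\rangle$, $a^\dagger|n\rangle=\sqrt{n+1}\,|n+1\rangle$); let $b,b^\dagger$ be the ladder operators of a second, ancillary mode. For $\alpha\in\mathbb C$ let $|\alpha\rangle=e^{-|\alpha|^2/2}\sum_n \frac{\alpha^n}{\sqrt{n!}}|n\rangle$ be the coherent state (the normalized eigenvector of $a$ with eigenvalue $\alpha$), let $D(\alpha)=\exp(\alpha a^\dagger-\alpha^* a)$ be the displacement operator, and let $\Pi(\alpha)=2\,D(\alpha)(-1)^{a^\dagger a}D^\dagger(\alpha)$ be the displaced parity operator. For a bounded operator $X$ on $\mathcal H$ define the quantum limited amplifier ($\kappa\ge 1$) and attenuator ($\lambda\in[0,1]$) by $$\mathcal A_\kappa(X)=\operatorname{Tr}_2\!\big[S_{12}(\kappa)\,(X\otimes|0\rangle\langle 0|)\,S_{12}^\dagger(\kappa)\big],\qquad S_{12}(\kappa)=\exp\!\big[\operatorname{arcosh}\sqrt\kappa\,(a^\dagger b^\dagger-ab)\big],$$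 $$\mathcal E_\lambda(X)=\operatorname{Tr}_2\!\big[B_{12}(\lambda)\,(X\otimes|0\rangle\langle 0|)\,B_{12}^\dagger(\lambda)\big],\qquad B_{12}(\lambda)=\exp\!\big[\arccos\sqrt\lambda\,(a^\dagger b-ab^\dagger)\big],$$ where the partial trace $\operatorname{Tr}_2 Y$ of a bounded operator $Y$ (when it exists) is the bounded operator $T$ with $\langle x|T|y\rangle=\sum_k\langle x\otimes e_k|Y|y\otimes e_k\rangle$ (unconditionally convergent) for all $x,y\in\mathcal H$ and every orthonormal basis $(e_k)$ of the ancillary mode. Let $\mathcal C=\mathcal E_{1/2}\circ\mathcal A_2$. Then for every $\alpha\in\mathbb C$ the partial traces involved below exist, and $$\mathcal C[\Pi(\alpha)]=|\alpha\rangle\langle\alpha|,\qquad \mathcal C^2[\Pi(\alpha)]=2\int_{\mathbb C}\frac{d^2\gamma}{\pi}\,e^{-2|\alpha-\gamma|^2}\,|\gamma\rangle\langle\gamma| ,$$ where $d^2\gamma=d\mathrm{Re}(\gamma)\,d\mathrm{Im}(\gamma)$ and the integral converges as a Bochner integral in operator norm. The right-hand side is a Gaussian mixture of coherent states: $\frac{2}{\pi}\int_{\mathbb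 C} e^{-2|\alpha-\gamma|^2}\,d^2\gamma=1$. -/

import Mathlib

noncomputable section

namespace BosonicModes

open scoped ComplexConjugate

/-! ### Fock spaces of one and of two bosonic modes -/

/-- The one-mode Hilbert space, with Fock basis indexed by `ℕ`. -/
abbrev Mode : Type := lp (fun _ : ℕ => ℂ) 2

/-- The two-mode Hilbert space (the Hilbert tensor product of two copies of `Mode`), with Fock
basis indexed by `ℕ × ℕ`: the basis vector of index `(m, n)` is the product vector `|m, n⟩`. -/
abbrev TwoMode : Type := lp (fun _ : ℕ × ℕ => ℂ) 2

theorem memlp_two_iff {ι : Type} (f : ι → ℂ) :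
    Memℓp f 2 ↔ Summable fun i => ‖f i‖ ^ 2 := by
  rw [memℓp_gen_iff (by norm_num)]
  simp

theorem lp_norm_sq {ι : Type} (x : lp (fun _ : ι => ℂ) 2) : ‖x‖ ^ 2 = ∑' i, ‖x i‖ ^ 2 := by
  have h := lp.norm_rpow_eq_tsum (p := 2) (by norm_num) x
  simpa using h

theorem lp_summable_sq {ι : Type} (x : lp (fun _ : ι => ℂ) 2) : Summable fun i => ‖x i‖ ^ 2 :=
  (memlp_two_iff _).1 (lp.memℓp x)

/-- The Fock state `|n⟩`. -/
def fock (n : ℕ) : Mode := lp.single 2 n (1 : ℂ)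

theorem memlp_tmul (x y : Mode) : Memℓp (fun p : ℕ × ℕ => x p.1 * y p.2) 2 := by
  rw [memlp_two_iff]
  simpa only [norm_mul, mul_pow] using
    (lp_summable_sq x).mul_of_nonneg (lp_summable_sq y)
      (fun _ => by positivity) (fun _ => by positivity)

/-- The bounded linear map `x ↦ x ⊗ y` from the first mode to the pair of modes. -/
def tmulRight (y : Mode) : Mode →L[ℂ] TwoMode :=
  LinearMap.mkContinuous
    { toFun := fun x => ⟨fun p => x p.1 * y p.2, memlp_tmul x y⟩
      map_add' := fun x x' => by
        ext p
        exact add_mul (x p.1) (x' p.1) (y p.2)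
      map_smul' := fun c x => by
        ext p
        simp [mul_assoc] }
    ‖y‖ (fun x => by
      refine le_of_sq_le_sq ?_ (by positivity)
      rw [lp_norm_sq, mul_pow, lp_norm_sq, lp_norm_sq x, mul_comm,
        Summable.tsum_mul_tsum (lp_summable_sq x) (lp_summable_sq y)]
      · simp [mul_pow]
      · exact (lp_summable_sq x).mul_of_nonneg (lp_summable_sq y)
          (fun _ => by positivity) (fun _ => by positivity))

/-- The product vector `x ⊗ y`. -/
def tmul (x y : Mode) : TwoMode := tmulRight y x

@[simp] theorem tmul_apply (x y : Mode) (p : ℕ × ℕ) : tmul x y p = x p.1 * y p.2 := rfl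

theorem inner_tmul_tmul (x y x' y' : Mode) :
    inner ℂ (tmul x y) (tmul x' y') = inner ℂ x x' * inner ℂ y y' := by
  have hx := lp.summable_inner (𝕜 := ℂ) x x'
  have hy := lp.summable_inner (𝕜 := ℂ) y y'
  rw [lp.inner_eq_tsum, lp.inner_eq_tsum, lp.inner_eq_tsum,
    tsum_mul_tsum_of_summable_norm hx.norm hy.norm]
  refine tsum_congr fun p => ?_
  simp only [tmul_apply, RCLike.inner_apply, map_mul]
  ring

/-- The bounded operator `X ⊗ |0⟩⟨0|`, where the second mode carries the vacuum. -/
def tensorVacuum (X : Mode →L[ℂ] Mode) : TwoMode →L[ℂ] TwoMode :=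
  tmulRight (fock 0) ∘L X ∘L ContinuousLinearMap.adjoint (tmulRight (fock 0))

/-- `(X ⊗ |0⟩⟨0|)(x ⊗ y) = X x ⊗ ⟨0|y⟩ |0⟩`, which determines the operator. -/
theorem tensorVacuum_tmul (X : Mode →L[ℂ] Mode) (x y : Mode) :
    tensorVacuum X (tmul x y) = tmul (X x) (inner ℂ (fock 0) y • fock 0) := by
  have h : ContinuousLinearMap.adjoint (tmulRight (fock 0)) (tmul x y) =
      inner ℂ (fock 0) y • x := by
    refine ext_inner_left ℂ fun v => ?_
    rw [ContinuousLinearMap.adjoint_inner_right]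
    change inner ℂ (tmul v (fock 0)) (tmul x y) = _
    rw [inner_tmul_tmul, inner_smul_right, mul_comm]
  ext p
  simp only [tensorVacuum, ContinuousLinearMap.comp_apply, h, map_smul]
  change _ * (X x p.1 * fock 0 p.2) = X x p.1 * (_ * fock 0 p.2)
  ring

/-! ### Ladder operators

Polynomials in the ladder operators act on the finite-particle vectors, i.e. on the finite linear
combinations of Fock states. -/

/-- The annihilation operator of one mode, `a |n⟩ = √n |n - 1⟩` (and `a |0⟩ = 0`). -/
def annihilate : Module.End ℂ (ℕ →₀ ℂ) :=
  Finsupp.linearCombination ℂ fun n => Finsupp.single (n - 1) ((√(n : ℝ) : ℝ) : ℂ)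

/-- The creation operator of one mode, `a† |n⟩ = √(n + 1) |n + 1⟩`. -/
def create : Module.End ℂ (ℕ →₀ ℂ) :=
  Finsupp.linearCombination ℂ fun n => Finsupp.single (n + 1) ((√((n : ℝ) + 1) : ℝ) : ℂ)

/-- The annihilation operator `a` of the first of two modes. -/
def annihilateFst : Module.End ℂ (ℕ × ℕ →₀ ℂ) :=
  Finsupp.linearCombination ℂ fun p => Finsupp.single (p.1 - 1, p.2) ((√(p.1 : ℝ) : ℝ) : ℂ)

/-- The creation operator `a†` of the first of two modes. -/
def createFst : Module.End ℂ (ℕ × ℕ →₀ ℂ) :=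
  Finsupp.linearCombination ℂ fun p =>
    Finsupp.single (p.1 + 1, p.2) ((√((p.1 : ℝ) + 1) : ℝ) : ℂ)

/-- The annihilation operator `b` of the second of two modes. -/
def annihilateSnd : Module.End ℂ (ℕ × ℕ →₀ ℂ) :=
  Finsupp.linearCombination ℂ fun p => Finsupp.single (p.1, p.2 - 1) ((√(p.2 : ℝ) : ℝ) : ℂ)

/-- The creation operator `b†` of the second of two modes. -/
def createSnd : Module.End ℂ (ℕ × ℕ →₀ ℂ) :=
  Finsupp.linearCombination ℂ fun p =>
    Finsupp.single (p.1, p.2 + 1) ((√((p.2 : ℝ) + 1) : ℝ) : ℂ)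

/-- The number operator satisfies `a† a |n⟩ = n |n⟩`. -/
theorem number_single (n : ℕ) :
    (create * annihilate) (Finsupp.single n 1) = (n : ℂ) • Finsupp.single n 1 := by
  rcases n with _ | n
  · simp [create, annihilate]
  · have h : ((√((n : ℝ) + 1) : ℝ) : ℂ) * ((√((n : ℝ) + 1) : ℝ) : ℂ) = (n : ℂ) + 1 := by
      rw [← Complex.ofReal_mul, Real.mul_self_sqrt (by positivity)]
      push_cast
      rfl
    simp [create, annihilate, h]

/-! ### Exponentials of skew-symmetric operators -/

/-- The finite-particle vectors as elements of the Hilbert space. -/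
def finiteParticle (ι : Type) [DecidableEq ι] : (ι →₀ ℂ) →ₗ[ℂ] lp (fun _ : ι => ℂ) 2 :=
  Finsupp.linearCombination ℂ fun i => lp.single 2 i (1 : ℂ)

/-- `U` is a strongly continuous one-parameter unitary group whose infinitesimal generator extends
the operator `K`, which is defined on the finite-particle vectors. -/
structure IsUnitaryGroup {ι : Type} [DecidableEq ι] (K : Module.End ℂ (ι →₀ ℂ))
    (U : ℝ → lp (fun _ : ι => ℂ) 2 →L[ℂ] lp (fun _ : ι => ℂ) 2) : Prop where
  unitary : ∀ t, U t ∈ unitary (lp (fun _ : ι => ℂ) 2 →L[ℂ] lp (fun _ : ι => ℂ) 2)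
  map_zero : U 0 = 1
  map_add : ∀ s t, U (s + t) = U s * U t
  continuous : ∀ x, Continuous fun t => U t x
  hasDerivAt : ∀ v, HasDerivAt (fun t => U t (finiteParticle ι v)) (finiteParticle ι (K v)) 0

open Classical in
/-- The unitary operator `exp K` for an (unbounded) operator `K` on the finite-particle vectors
that is essentially skew-adjoint: the value at time `1` of the unitary group `exp (t K)`, which is
the only one whose generator extends `K`. (If there is no such group, or more than one, the value
is `0`.) -/
def unitaryExp {ι : Type} [DecidableEq ι] (K : Module.End ℂ (ι →₀ ℂ)) :
    lp (fun _ : ι => ℂ) 2 →L[ℂ] lp (fun _ : ι => ℂ) 2 :=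
  if h : ∃! U : ℝ → lp (fun _ : ι => ℂ) 2 →L[ℂ] lp (fun _ : ι => ℂ) 2, IsUnitaryGroup K U then
    h.choose 1
  else 0

/-- The displacement operator `D(β) = exp (β a† - β* a)`. -/
def displacement (β : ℂ) : Mode →L[ℂ] Mode :=
  unitaryExp (β • create - conj β • annihilate)

/-- The two-mode squeezing operator `S₁₂(κ) = exp (arcosh √κ (a† b† - a b))`. -/
def squeezing (κ : ℝ) : TwoMode →L[ℂ] TwoMode :=
  unitaryExp (((Real.arcosh √κ : ℝ) : ℂ) •
    (createFst * createSnd - annihilateFst * annihilateSnd))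

/-- The two-mode beamsplitter operator `B₁₂(λ) = exp (arccos √λ (a† b - a b†))`. -/
def beamsplitter (lam : ℝ) : TwoMode →L[ℂ] TwoMode :=
  unitaryExp (((Real.arccos √lam : ℝ) : ℂ) •
    (createFst * annihilateSnd - annihilateFst * createSnd))

/-! ### Partial trace and the channels -/

/-- `T` is the partial trace of `Y` over the second mode: for every orthonormal basis `b` of the
second mode, `⟨x|T|y⟩ = ∑ₖ ⟨x ⊗ bₖ|Y|y ⊗ bₖ⟩`, the series being unconditionally convergent. For
trace class `Y` this is the usual partial trace. -/
def IsPartialTrace (Y : TwoMode →L[ℂ] TwoMode) (T : Mode →L[ℂ] Mode) : Prop :=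
  ∀ (b : HilbertBasis ℕ ℂ Mode) (x y : Mode),
    HasSum (fun k => inner ℂ (tmul x (b k)) (Y (tmul y (b k)))) (inner ℂ x (T y))

/-- The Fock basis of one mode. -/
def fockBasis : HilbertBasis ℕ ℂ Mode := HilbertBasis.ofRepr (LinearIsometryEquiv.refl ℂ Mode)

/-- The partial trace is unique. -/
theorem IsPartialTrace.unique {Y : TwoMode →L[ℂ] TwoMode} {T T' : Mode →L[ℂ] Mode}
    (h : IsPartialTrace Y T) (h' : IsPartialTrace Y T') : T = T' := by
  ext1 y
  exact ext_inner_left ℂ fun x => (h fockBasis x y).unique (h' fockBasis x y)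

open Classical in
/-- The partial trace `Tr₂ Y` (with value `0` if `Y` has no partial trace). -/
def partialTrace (Y : TwoMode →L[ℂ] TwoMode) : Mode →L[ℂ] Mode :=
  if h : ∃ T, IsPartialTrace Y T then h.choose else 0

/-- The quantum limited amplifier `A_κ(X) = Tr₂ [S₁₂(κ) (X ⊗ |0⟩⟨0|) S₁₂(κ)†]`. -/
def amplifier (κ : ℝ) (X : Mode →L[ℂ] Mode) : Mode →L[ℂ] Mode :=
  partialTrace (squeezing κ ∘L tensorVacuum X ∘L ContinuousLinearMap.adjoint (squeezing κ))

/-- The quantum limited attenuator `E_λ(X) = Tr₂ [B₁₂(λ) (X ⊗ |0⟩⟨0|) B₁₂(λ)†]`. -/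
def attenuator (lam : ℝ) (X : Mode →L[ℂ] Mode) : Mode →L[ℂ] Mode :=
  partialTrace
    (beamsplitter lam ∘L tensorVacuum X ∘L ContinuousLinearMap.adjoint (beamsplitter lam))

/-- The channel `C = E_{1/2} ∘ A_2`. -/
def channelC : (Mode →L[ℂ] Mode) → (Mode →L[ℂ] Mode) :=
  attenuator (1 / 2) ∘ amplifier 2

/-! ### Displaced parity and coherent states -/

/-- The parity operator `(-1)^{a† a}`, i.e. `(-1)^{a† a} |n⟩ = (-1)^n |n⟩`. -/
def parity : Mode →L[ℂ] Mode :=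
  LinearMap.mkContinuous
    { toFun := fun x => ⟨fun n => (-1) ^ n * x n, (memlp_two_iff _).2 (by simpa using lp_summable_sq x)⟩
      map_add' := fun x y => by
        ext n
        exact mul_add ((-1) ^ n) (x n) (y n)
      map_smul' := fun c x => by
        ext n
        simp [mul_left_comm] }
    1 (fun x => by
      refine le_of_sq_le_sq ?_ (by positivity)
      rw [one_mul, lp_norm_sq, lp_norm_sq]
      simp)

@[simp] theorem parity_apply (x : Mode) (n : ℕ) : parity x n = (-1) ^ n * x n := rfl

/-- The displaced parity operator `Π(α) = 2 D(α) (-1)^{a† a} D(α)†`. -/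
def displacedParity (α : ℂ) : Mode →L[ℂ] Mode :=
  (2 : ℂ) • (displacement α ∘L parity ∘L ContinuousLinearMap.adjoint (displacement α))

theorem coherent_hasSum (α : ℂ) :
    HasSum (fun n : ℕ => ‖(Real.exp (-‖α‖ ^ 2 / 2) : ℂ) * (α ^ n / (√(n.factorial : ℝ) : ℝ))‖ ^ 2)
      1 := by
  have h := (NormedSpace.expSeries_div_hasSum_exp (‖α‖ ^ 2)).mul_left (Real.exp (-‖α‖ ^ 2))
  rw [← Real.exp_eq_exp_ℝ, ← Real.exp_add, neg_add_cancel, Real.exp_zero] at h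
  refine h.congr_fun fun n => ?_
  have h1 : Real.exp (-‖α‖ ^ 2 / 2) ^ 2 = Real.exp (-‖α‖ ^ 2) := by
    rw [← Real.exp_nat_mul]
    congr 1
    push_cast
    ring
  rw [norm_mul, norm_div, norm_pow, Complex.norm_real, Complex.norm_real, mul_pow, div_pow,
    Real.norm_eq_abs, Real.norm_eq_abs, sq_abs, sq_abs, Real.sq_sqrt (by positivity), h1,
    ← pow_mul, ← pow_mul, mul_comm n 2]

/-- The coherent state `|α⟩ = e^{-|α|²/2} ∑ₙ αⁿ/√(n!) |n⟩`, the normalized eigenvector of the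
annihilation operator with eigenvalue `α`. -/
def coherent (α : ℂ) : Mode :=
  ⟨fun n => (Real.exp (-‖α‖ ^ 2 / 2) : ℂ) * (α ^ n / (√(n.factorial : ℝ) : ℝ)),
    (memlp_two_iff _).2 (coherent_hasSum α).summable⟩

theorem coherent_apply (α : ℂ) (n : ℕ) :
    coherent α n = (Real.exp (-‖α‖ ^ 2 / 2) : ℂ) * (α ^ n / (√(n.factorial : ℝ) : ℝ)) := rfl

theorem norm_coherent (α : ℂ) : ‖coherent α‖ = 1 := by
  have h : ‖coherent α‖ ^ 2 = 1 := by
    rw [lp_norm_sq]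
    exact (coherent_hasSum α).tsum_eq
  exact (pow_eq_one_iff_of_nonneg (norm_nonneg _) two_ne_zero).1 h

/-- The eigenvalue equation `a |α⟩ = α |α⟩` in Fock coordinates. -/
theorem coherent_eigen (α : ℂ) (n : ℕ) :
    ((√((n : ℝ) + 1) : ℝ) : ℂ) * coherent α (n + 1) = α * coherent α n := by
  have h : ((√((n : ℝ) + 1) : ℝ) : ℂ) ≠ 0 := by
    rw [Complex.ofReal_ne_zero]
    positivity
  rw [coherent_apply, coherent_apply, Nat.factorial_succ, Nat.cast_mul,
    Real.sqrt_mul (by positivity)]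
  push_cast at h ⊢
  field_simp
  ring

/-- The projector `|α⟩⟨α|` onto a coherent state. -/
def coherentProj (α : ℂ) : Mode →L[ℂ] Mode :=
  InnerProductSpace.rankOne ℂ (coherent α) (coherent α)

end BosonicModes

end

noncomputable section

namespace BosonicModes

open scoped ComplexConjugate Nat
open Finset.HasAntidiagonal (antidiagonal)

/-! ### Summation over antidiagonals -/

/-! Everything is computed on the exponential vectors `e_z = ∑ zⁿ/√(n!) |n⟩`. They are total, so a
bounded operator `X` is determined by its kernel `⟨e_z|X|e_w⟩` (`operator_ext_expVec`). In kernel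
form the amplifier is `⟨e_z|A_2(X)|e_w⟩ = ½ exp(z̄w/2) ⟨e_{z/√2}|X|e_{w/√2}⟩`
(`inner_expVec_amplifier`). Since `Π(α)` sends `e_w` to a multiple of `e_{2α-w}`, the cross term
`-z̄w/2` of its rescaled kernel cancels the factor `exp(z̄w/2)`, and what is left is the kernel of
the projector onto `|√2 α⟩`. The beamsplitter turns `|√2 γ, 0⟩` into `|γ, -γ⟩`, so the attenuator
takes that projector to `|α⟩⟨α|`. For the second application, a Gaussian integral identifies
`A_2(|α⟩⟨α|)` with a Gaussian mixture of projectors onto `|√2 γ⟩`, and the attenuator passes through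
the mixture by dominated convergence.

Two analytic points carry the weight. The unitaries are defined through unbounded generators:
existence of the groups comes from Nelson's analytic vectors
(`IsAnalyticFor.exists_isUnitaryGroup`), uniqueness from the vanishing of bounded weak solutions
with zero initial value, and the same uniqueness lets any explicit bounded weak solution of `f' = K
f` be recognised as an orbit (`unitaryExp_apply_of_weak`). Moreover `Π(α)` is not trace class, so
the amplifier's partial trace rests on `y ↦ W†(x ⊗ y)` being Hilbert–Schmidt, `W` being the
amplifier isometry; independence of the basis then follows by polarization. -/

theorem tsum_coe_antidiagonal {E : Type*} [AddCommMonoid E] [TopologicalSpace E] (f : ℕ × ℕ → E)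
    (n : ℕ) :
    ∑' y : antidiagonal n, f y = ∑ p ∈ antidiagonal n, f p := by
  rw [tsum_fintype]
  exact Finset.sum_coe_sort (antidiagonal n) f

theorem summable_prod_iff_antidiagonal {f : ℕ × ℕ → ℝ} (hf : ∀ p, 0 ≤ f p) :
    Summable f ↔ Summable fun n => ∑ p ∈ antidiagonal n, f p := by
  rw [← Finset.HasAntidiagonal.sigmaAntidiagonalEquivProd.summable_iff,
    summable_sigma_of_nonneg (f := f ∘ _) fun _ => hf _]
  have h (n : ℕ) := tsum_coe_antidiagonal f n
  simp only [Function.comp_apply, Finset.HasAntidiagonal.sigmaAntidiagonalEquivProd_apply, h]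
  exact and_iff_right fun n => (hasSum_fintype _).summable

theorem tsum_prod_eq_tsum_antidiagonal {E : Type*} [NormedAddCommGroup E] [CompleteSpace E]
    {f : ℕ × ℕ → E} (hf : Summable f) :
    ∑' p, f p = ∑' n, ∑ p ∈ antidiagonal n, f p := by
  rw [← Finset.HasAntidiagonal.sigmaAntidiagonalEquivProd.tsum_eq f]
  have hs := Finset.HasAntidiagonal.sigmaAntidiagonalEquivProd.summable_iff.2 hf
  exact (hs.tsum_sigma' fun n => (hasSum_fintype _).summable).trans
    (tsum_congr fun n => tsum_coe_antidiagonal f n)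

theorem sum_antidiagonal_pow_div_factorial (a b : ℝ) (n : ℕ) :
    ∑ p ∈ antidiagonal n, a ^ p.1 / p.1 ! * (b ^ p.2 / p.2 !) = (a + b) ^ n / n ! := by
  rw [(Commute.all a b).add_pow', Finset.sum_div]
  refine Finset.sum_congr rfl fun p hp => ?_
  have h := Nat.add_choose_mul_factorial_mul_factorial p.1 p.2
  rw [Finset.HasAntidiagonal.mem_antidiagonal.1 hp] at h
  rw [nsmul_eq_mul, ← h,
    Nat.choose_symm_of_eq_add (Finset.HasAntidiagonal.mem_antidiagonal.1 hp).symm]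
  have := Nat.choose_pos (antidiagonal.snd_le hp)
  push_cast
  field_simp

/-! ### Exponential series with coefficients in a Banach space -/

section ExponentialSeries

variable {E : Type*} [NormedAddCommGroup E] [NormedSpace ℝ E] [CompleteSpace E]

/-- The binomial theorem on each antidiagonal; absolute convergence holds because the norms there
add up to `(|s| + |t|)ⁿ/n! * ‖g n‖`. With vectors `g n = Kⁿ v` this gives the group law, with
scalars `⟨v, Kⁿ w⟩` the preservation of inner products. -/
theorem hasSum_exp_add {g : ℕ → E} {r s t : ℝ}
    (hg : Summable fun n => r ^ n / n ! * ‖g n‖) (hst : |s| + |t| ≤ r) :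
    HasSum (fun p : ℕ × ℕ => (s ^ p.1 / p.1 ! * (t ^ p.2 / p.2 !)) • g (p.1 + p.2))
      (∑' n, ((s + t) ^ n / n !) • g n) := by
  have hs : Summable (fun p : ℕ × ℕ =>
      (s ^ p.1 / p.1 ! * (t ^ p.2 / p.2 !)) • g (p.1 + p.2)) := by
    refine Summable.of_norm ?_
    rw [summable_prod_iff_antidiagonal fun _ => norm_nonneg _]
    refine hg.of_nonneg_of_le (fun n => Finset.sum_nonneg fun _ _ => norm_nonneg _) fun n => ?_
    have h : ∀ p ∈ antidiagonal n,
        ‖(s ^ p.1 / p.1 ! * (t ^ p.2 / p.2 !)) • g (p.1 + p.2)‖ =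
          (|s| ^ p.1 / p.1 ! * (|t| ^ p.2 / p.2 !)) * ‖g n‖ := fun p hp => by
      rw [Finset.HasAntidiagonal.mem_antidiagonal.1 hp, norm_smul]
      simp
    rw [Finset.sum_congr rfl h, ← Finset.sum_mul, sum_antidiagonal_pow_div_factorial]
    gcongr
  convert! hs.hasSum using 1
  rw [tsum_prod_eq_tsum_antidiagonal hs]
  refine tsum_congr fun n => ?_
  rw [← sum_antidiagonal_pow_div_factorial, Finset.sum_smul]
  refine Finset.sum_congr rfl fun p hp => ?_
  rw [Finset.HasAntidiagonal.mem_antidiagonal.1 hp]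

theorem summable_exp_smul {g : ℕ → E} {r t : ℝ}
    (hg : Summable fun n => r ^ n / n ! * ‖g n‖) (ht : |t| ≤ r) :
    Summable fun n => (t ^ n / n !) • g n := by
  refine Summable.of_norm_bounded hg fun n => ?_
  rw [norm_smul, norm_div, norm_pow, Real.norm_eq_abs, Real.norm_natCast]
  gcongr

theorem hasDerivAt_exp_smul {g : ℕ → E} {r : ℝ} (hr : 0 < r)
    (hg : Summable fun n => r ^ n / n ! * ‖g n‖) :
    HasDerivAt (fun t : ℝ => ∑' n, (t ^ n / n !) • g n) (g 1) 0 := by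
  have hg2 := (summable_nat_add_iff 2).2 hg
  set C := ∑' n, r ^ (n + 2) / (n + 2)! * ‖g (n + 2)‖
  rw [hasDerivAt_iff_isLittleO]
  -- After the terms `n = 0, 1` are removed, the tail is at most `(t/r)²` times its value at `r`.
  have hO : (fun t : ℝ => (∑' n, (t ^ n / n !) • g n) - (∑' n, ((0 : ℝ) ^ n / n !) • g n) -
      (t - 0) • g 1) =O[nhds 0] fun t : ℝ => t ^ 2 := by
    refine Asymptotics.IsBigO.of_bound (C / r ^ 2) ?_
    filter_upwards [Metric.closedBall_mem_nhds (0 : ℝ) hr] with t ht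
    replace ht : |t| ≤ r := by simpa using ht
    have h0 : (∑' n, ((0 : ℝ) ^ n / n !) • g n) = g 0 := by
      rw [tsum_eq_single 0 (fun n hn => by simp [hn])]
      simp
    have h1 := (summable_exp_smul hg ht).sum_add_tsum_nat_add 2
    rw [h0, ← h1]
    simp only [Finset.sum_range_succ, Finset.sum_range_zero, pow_zero, pow_one, Nat.factorial,
      sub_zero]
    have h2 : ‖∑' n, (t ^ (n + 2) / (n + 2)!) • g (n + 2)‖ ≤ ∑' n, t ^ 2 / r ^ 2 *
        (r ^ (n + 2) / (n + 2)! * ‖g (n + 2)‖) := by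
      refine tsum_of_norm_bounded (hg2.mul_left _).hasSum fun n => ?_
      rw [norm_smul, norm_div, norm_pow, Real.norm_eq_abs, Real.norm_natCast, pow_add, pow_add,
        sq_abs]
      have : |t| ^ n ≤ r ^ n := by gcongr
      calc |t| ^ n * t ^ 2 / (n + 2)! * ‖g (n + 2)‖
          ≤ r ^ n * t ^ 2 / (n + 2)! * ‖g (n + 2)‖ := by gcongr
        _ = _ := by field_simp
    rw [tsum_mul_left] at h2
    convert h2 using 1
    · congr 1
      simp only [Nat.factorial, Nat.cast_one, div_one, one_smul, mul_one]
      abel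
    · rw [Real.norm_eq_abs, abs_of_nonneg (sq_nonneg t)]
      ring
  refine hO.trans_isLittleO ?_
  simpa using! Asymptotics.isLittleO_pow_id (𝕜 := ℝ) (n := 2) (by norm_num)

end ExponentialSeries

/-! ### Extension of local one-parameter groups -/

/-- A one-parameter family in a monoid that is multiplicative near `0` extends to a one-parameter
group. -/
theorem exists_oneParameterGroup {M : Type*} [Monoid M] {V : ℝ → M} {ρ : ℝ} (hρ : 0 < ρ)
    (h0 : V 0 = 1) (hadd : ∀ s t, |s| + |t| ≤ ρ → V (s + t) = V s * V t) (S : Submonoid M)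
    (hS : ∀ t, |t| ≤ ρ → V t ∈ S) :
    ∃ U : ℝ → M, (∀ t, U t ∈ S) ∧ (∀ s t, U (s + t) = U s * U t) ∧ ∀ t, |t| ≤ ρ → U t = V t := by
  have hpow (m : ℕ) : ∀ u : ℝ, m * |u| ≤ ρ → V (m * u) = V u ^ m := by
    induction m with
    | zero => intro u _; simp [h0]
    | succ m ih =>
      intro u hu
      push_cast at hu
      have hu' : m * |u| + |u| ≤ ρ := by linarith
      rw [pow_succ, ← ih u (by linarith [abs_nonneg u]), ← hadd]
      · push_cast
        ring_nf
      · rwa [abs_mul, Nat.abs_cast]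
  have hdiv {n m : ℕ} (hn : 0 < n) (hm : 0 < m) {t : ℝ} (ht : |t| ≤ n * ρ) :
      V (t / n) ^ n = V (t / (n * m)) ^ (n * m) := by
    rw [mul_comm n m, pow_mul, ← hpow m (t / (n * m))]
    · congr 2
      field_simp
    · rw [abs_div, abs_of_pos (by positivity : (0 : ℝ) < n * m)]
      have : (m : ℝ) * (|t| / (n * m)) = |t| / n := by field_simp
      rw [this, div_le_iff₀ (by positivity)]
      linarith
  -- The number of pieces into which `t` is cut; the `+ 1` keeps it positive. By `hdiv`, any two
  -- admissible numbers of pieces agree through their common refinement, so `U` does not depend on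
  -- this choice.
  let N (t : ℝ) : ℕ := ⌈|t| / ρ⌉₊ + 1
  have hN (t : ℝ) : |t| ≤ N t * ρ := by
    rw [← div_le_iff₀ hρ]
    refine (Nat.le_ceil _).trans ?_
    simp [N]
  have hNpos (t : ℝ) : 0 < N t := Nat.succ_pos _
  let U (t : ℝ) : M := V (t / N t) ^ N t
  have key {n : ℕ} (hn : 0 < n) {t : ℝ} (ht : |t| ≤ n * ρ) : U t = V (t / n) ^ n := by
    rw [hdiv hn (hNpos t) ht]
    change V (t / N t) ^ N t = _
    rw [hdiv (hNpos t) hn (hN t), mul_comm n, mul_comm (n : ℝ)]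
  refine ⟨U, fun t => ?_, fun s t => ?_, fun t ht => ?_⟩
  · refine pow_mem (hS _ ?_) _
    have := hNpos t
    rw [abs_div, Nat.abs_cast, div_le_iff₀ (by positivity), mul_comm]
    exact hN t
  -- Cutting `s` and `t` into the same number of pieces makes the pieces small enough for the local
  -- law, which also shows that they commute.
  · have hn : 0 < N s + N t := Nat.add_pos_left (hNpos s) _
    have hle : |s| + |t| ≤ ((N s + N t : ℕ) : ℝ) * ρ := by
      push_cast
      linarith [hN s, hN t]
    have h1 : |s / ((N s + N t : ℕ) : ℝ)| + |t / ((N s + N t : ℕ) : ℝ)| ≤ ρ := by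
      rw [abs_div, abs_div, Nat.abs_cast, ← add_div, div_le_iff₀ (by positivity), mul_comm]
      exact hle
    rw [key hn ((abs_add_le s t).trans hle), key hn (by linarith [abs_nonneg t] : |s| ≤ _),
      key hn (by linarith [abs_nonneg s] : |t| ≤ _), add_div, hadd _ _ h1]
    refine Commute.mul_pow ?_ _
    rw [Commute, SemiconjBy, ← hadd _ _ h1, ← hadd _ _ (by rwa [add_comm]), add_comm]
  · simpa using key one_pos (by simpa using ht)

/-! ### Unitary groups generated by skew-symmetric operators with analytic vectors -/

section Nelson

variable {ι : Type} [DecidableEq ι] {K : Module.End ℂ (ι →₀ ℂ)}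

theorem finiteParticle_single (i : ι) (c : ℂ) :
    finiteParticle ι (Finsupp.single i c) = c • lp.single 2 i (1 : ℂ) := by
  simp [finiteParticle]

theorem inner_single_one (i : ι) (x : lp (fun _ : ι => ℂ) 2) :
    inner ℂ (lp.single 2 i (1 : ℂ)) x = x i := by
  simp [lp.inner_single_left]

theorem denseRange_finiteParticle : DenseRange (finiteParticle ι) := fun x => by
  refine mem_closure_of_tendsto (lp.hasSum_single (by norm_num) x) (Filter.Eventually.of_forall ?_)
  intro s
  refine ⟨∑ i ∈ s, Finsupp.single i (x i), ?_⟩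
  rw [map_sum]
  refine Finset.sum_congr rfl fun i _ => ?_
  rw [finiteParticle_single, ← lp.single_smul]
  simp

/-- `K` is skew-symmetric on the finite-particle vectors. -/
def IsSkew (K : Module.End ℂ (ι →₀ ℂ)) : Prop :=
  ∀ v w, inner ℂ (finiteParticle ι (K v)) (finiteParticle ι w) =
    -inner ℂ (finiteParticle ι v) (finiteParticle ι (K w))

/-- All finite-particle vectors are analytic for `K`, with radius of convergence at least `r`. -/
def IsAnalyticFor (K : Module.End ℂ (ι →₀ ℂ)) (r : ℝ) : Prop :=
  ∀ v, Summable fun n : ℕ => r ^ n / n ! * ‖finiteParticle ι ((K ^ n) v)‖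

theorem IsSkew.pow (hK : IsSkew K) (n : ℕ) (v w : ι →₀ ℂ) :
    inner ℂ (finiteParticle ι ((K ^ n) v)) (finiteParticle ι w) =
      (-1) ^ n * inner ℂ (finiteParticle ι v) (finiteParticle ι ((K ^ n) w)) := by
  induction n generalizing v with
  | zero => simp
  | succ n ih =>
    rw [pow_succ, Module.End.mul_apply, ih, hK, ← Module.End.mul_apply, ← pow_succ', pow_succ K,
      pow_succ (-1 : ℂ)]
    ring

theorem clm_mul_apply {H : Type*} [NormedAddCommGroup H] [InnerProductSpace ℂ H] (A B : H →L[ℂ] H)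
    (x : H) : (A * B) x = A (B x) := rfl

theorem real_smul_inner_left {H : Type*} [NormedAddCommGroup H] [InnerProductSpace ℂ H]
    [Module ℝ H] [IsScalarTower ℝ ℂ H] (c : ℝ) (x y : H) : inner ℂ (c • x) y = c • inner ℂ x y := by
  rw [RCLike.real_smul_eq_coe_smul (K := ℂ), inner_smul_real_left]

theorem real_smul_inner_right {H : Type*} [NormedAddCommGroup H] [InnerProductSpace ℂ H]
    [Module ℝ H] [IsScalarTower ℝ ℂ H] (c : ℝ) (x y : H) : inner ℂ x (c • y) = c • inner ℂ x y := by
  rw [RCLike.real_smul_eq_coe_smul (K := ℂ), inner_smul_real_right]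

variable (K) in
/-- The exponential series of `t K` on a finite-particle vector. -/
def expSeries (t : ℝ) (v : ι →₀ ℂ) : lp (fun _ : ι => ℂ) 2 :=
  ∑' n : ℕ, (t ^ n / n !) • finiteParticle ι ((K ^ n) v)

theorem IsAnalyticFor.summable {r t : ℝ} (hA : IsAnalyticFor K r) (ht : |t| ≤ r) (v : ι →₀ ℂ) :
    Summable fun n : ℕ => (t ^ n / n !) • finiteParticle ι ((K ^ n) v) :=
  summable_exp_smul (hA v) ht

/-- Skewness turns the `(m, n)` term of the double series into `(-t)^m t^n/(m! n!) ⟨v, K^(m+n) w⟩`,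
so the sum is the exponential series at time `-t + t = 0`. Absolute convergence costs half the
radius. -/
theorem IsAnalyticFor.inner_expSeries {r t : ℝ} (hA : IsAnalyticFor K r) (hK : IsSkew K)
    (ht : |t| + |t| ≤ r) (v w : ι →₀ ℂ) :
    inner ℂ (expSeries K t v) (expSeries K t w) =
      inner ℂ (finiteParticle ι v) (finiteParticle ι w) := by
  have ht' : |t| ≤ r := by linarith [abs_nonneg t]
  set g : ℕ → ℂ := fun n => inner ℂ (finiteParticle ι v) (finiteParticle ι ((K ^ n) w)) with hgdef
  have hg : Summable fun n => r ^ n / n ! * ‖g n‖ := by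
    refine ((hA w).mul_left ‖finiteParticle ι v‖).of_nonneg_of_le (fun n => ?_) fun n => ?_
    · have : 0 ≤ r := (abs_nonneg t).trans ht'
      positivity
    · have h := norm_inner_le_norm (𝕜 := ℂ) (finiteParticle ι v) (finiteParticle ι ((K ^ n) w))
      have hr : 0 ≤ r ^ n / n ! := by
        have : 0 ≤ r := (abs_nonneg t).trans ht'
        positivity
      calc _ ≤ r ^ n / n ! * (‖finiteParticle ι v‖ * ‖finiteParticle ι ((K ^ n) w)‖) := by gcongr
        _ = _ := by ring
  have h := hasSum_exp_add hg (s := -t) (t := t) (by rwa [abs_neg])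
  have h0 : (∑' n, (((-t) + t) ^ n / n !) • g n) = g 0 := by
    rw [tsum_eq_single 0 (fun n hn => by simp [hn])]
    simp
  rw [h0] at h
  have hterm (m n : ℕ) : ((-t) ^ m / m ! * (t ^ n / n !)) • g (m + n) =
      inner ℂ ((t ^ m / m !) • finiteParticle ι ((K ^ m) v))
        ((t ^ n / n !) • finiteParticle ι ((K ^ n) w)) := by
    rw [real_smul_inner_left, real_smul_inner_right, hK.pow, ← Module.End.mul_apply, ← pow_add,
      neg_pow]
    simp only [hgdef, Complex.real_smul]
    push_cast
    ring
  have h1 : g 0 = inner ℂ (finiteParticle ι v) (finiteParticle ι w) := by simp [hgdef]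
  rw [← h1, ← h.tsum_eq, h.summable.tsum_prod]
  have hv := (hA.summable ht' v).hasSum
  have hw := (hA.summable ht' w).hasSum
  have hl := ((innerSLFlip ℂ (expSeries K t w)).hasSum hv).tsum_eq
  simp only [innerSLFlip_apply_apply] at hl
  refine hl.symm.trans (tsum_congr fun m => ?_)
  have hr := ((innerSL ℂ ((t ^ m / m !) • finiteParticle ι ((K ^ m) v))).hasSum hw).tsum_eq
  simp only [innerSL_apply_apply] at hr
  exact hr.symm.trans (tsum_congr fun n => (hterm m n).symm)

variable (K) in
/-- The linear map `v ↦ exp (t K) v` on the finite-particle vectors. -/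
def expSeriesLinear {r t : ℝ} (hA : IsAnalyticFor K r) (ht : |t| ≤ r) :
    (ι →₀ ℂ) →ₗ[ℂ] lp (fun _ : ι => ℂ) 2 where
  toFun := expSeries K t
  map_add' v w := by
    rw [expSeries, expSeries, expSeries, ← (hA.summable ht v).tsum_add (hA.summable ht w)]
    simp only [map_add, smul_add]
  map_smul' c v := by
    rw [expSeries, expSeries, RingHom.id_apply, ← (hA.summable ht v).tsum_const_smul c]
    simp only [map_smul]
    refine tsum_congr fun n => smul_comm _ _ _

/-- The series is isometric on the dense subspace of finite-particle vectors, hence extends by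
continuity; times outside the range get the junk value `0`. -/
theorem IsAnalyticFor.exists_local {r : ℝ} (hA : IsAnalyticFor K r) (hK : IsSkew K) :
    ∃ V : ℝ → lp (fun _ : ι => ℂ) 2 →L[ℂ] lp (fun _ : ι => ℂ) 2, ∀ t, |t| + |t| ≤ r →
      (∀ v, V t (finiteParticle ι v) = expSeries K t v) ∧ ∀ x, ‖V t x‖ = ‖x‖ := by
  have (t : ℝ) : ∃ V : lp (fun _ : ι => ℂ) 2 →L[ℂ] lp (fun _ : ι => ℂ) 2, |t| + |t| ≤ r →
      (∀ v, V (finiteParticle ι v) = expSeries K t v) ∧ ∀ x, ‖V x‖ = ‖x‖ := by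
    by_cases ht : |t| + |t| ≤ r
    · have ht' : |t| ≤ r := by linarith [abs_nonneg t]
      have hn (v : ι →₀ ℂ) : ‖expSeriesLinear K hA ht' v‖ = ‖finiteParticle ι v‖ := by
        have h := hA.inner_expSeries hK ht v v
        rw [inner_self_eq_norm_sq_to_K, inner_self_eq_norm_sq_to_K] at h
        have h' : ‖expSeries K t v‖ ^ 2 = ‖finiteParticle ι v‖ ^ 2 := by exact_mod_cast h
        exact (pow_left_inj₀ (norm_nonneg _) (norm_nonneg _) two_ne_zero).1 h'
      have hV := LinearMap.extendOfNorm_eq (f := expSeriesLinear K hA ht') denseRange_finiteParticle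
        ⟨1, fun v => by rw [one_mul, hn]⟩
      refine ⟨_, fun _ => ⟨hV, fun x => ?_⟩⟩
      refine denseRange_finiteParticle.induction_on x (isClosed_eq ?_ ?_) fun v => ?_
      · fun_prop
      · fun_prop
      · rw [hV, hn]
    · exact ⟨0, fun h => absurd h ht⟩
  choose V hV using this
  exact ⟨V, hV⟩

theorem IsAnalyticFor.exists_isUnitaryGroup {r : ℝ} (hr : 0 < r) (hA : IsAnalyticFor K r)
    (hK : IsSkew K) :
    ∃ U : ℝ → lp (fun _ : ι => ℂ) 2 →L[ℂ] lp (fun _ : ι => ℂ) 2, IsUnitaryGroup K U := by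
  obtain ⟨V, hV⟩ := hA.exists_local hK
  have hsmall {t : ℝ} (ht : |t| ≤ r / 2) : |t| + |t| ≤ r := by linarith
  have hV0 : V 0 = 1 := by
    refine DFunLike.ext _ _ fun x => ?_
    refine denseRange_finiteParticle.induction_on x (isClosed_eq (by fun_prop) (by fun_prop))
      fun v => ?_
    rw [(hV 0 (by simpa using hr.le)).1, expSeries, tsum_eq_single 0 (fun n hn => by simp [hn])]
    simp
  have hadd (s t : ℝ) (hst : |s| + |t| ≤ r / 2) : V (s + t) = V s * V t := by
    have hs : |s| ≤ r / 2 := by linarith [abs_nonneg t]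
    have ht : |t| ≤ r / 2 := by linarith [abs_nonneg s]
    refine DFunLike.ext _ _ fun x => ?_
    refine denseRange_finiteParticle.induction_on x (isClosed_eq (by fun_prop) (by fun_prop))
      fun v => ?_
    rw [(hV _ (hsmall ((abs_add_le s t).trans hst))).1, clm_mul_apply,
      (hV t (hsmall ht)).1, expSeries, expSeries]
    have h := hasSum_exp_add (hA v) (s := t) (t := s) (by linarith)
    rw [add_comm s t, ← h.tsum_eq, h.summable.tsum_prod]
    have hv := ((V s).hasSum (hA.summable (by linarith) v : Summable fun n : ℕ =>
      (t ^ n / n !) • finiteParticle ι ((K ^ n) v)).hasSum).tsum_eq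
    refine Eq.trans (tsum_congr fun n => ?_) hv
    rw [ContinuousLinearMap.map_smul_of_tower, (hV s (hsmall hs)).1, expSeries,
      ← (hA.summable (by linarith) _).tsum_const_smul]
    refine tsum_congr fun m => ?_
    rw [← Module.End.mul_apply, ← pow_add, add_comm m n, smul_smul]
  -- An isometry still needs a right inverse. It is `V (-t)`, and the local law for `t` and `-t`
  -- requires `|t| ≤ r / 4`.
  have hunit (t : ℝ) (ht : |t| ≤ r / 4) :
      V t ∈ unitary (lp (fun _ : ι => ℂ) 2 →L[ℂ] lp (fun _ : ι => ℂ) 2) := by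
    have h1 : star (V t) * V t = 1 :=
      (ContinuousLinearMap.norm_map_iff_adjoint_comp_self (V t)).1 (hV t (by linarith)).2
    have h2 : V t * V (-t) = 1 := by
      rw [← hadd t (-t) (by rw [abs_neg]; linarith), add_neg_cancel, hV0]
    refine Unitary.mem_iff.2 ⟨h1, ?_⟩
    rwa [left_inv_eq_right_inv h1 h2]
  obtain ⟨U, hU, hUadd, hUV⟩ := exists_oneParameterGroup (ρ := r / 4) (by linarith) hV0
    (fun s t h => hadd s t (by linarith)) (unitary _) hunit
  have hnear : ∀ᶠ t in nhds (0 : ℝ), |t| ≤ r / 4 := by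
    filter_upwards [Metric.closedBall_mem_nhds (0 : ℝ) (by linarith : 0 < r / 4)] with t ht
    simpa using ht
  have hnorm (t : ℝ) (x : lp (fun _ : ι => ℂ) 2) : ‖U t x‖ = ‖x‖ :=
    (ContinuousLinearMap.norm_map_iff_adjoint_comp_self (U t)).2 (Unitary.mem_iff.1 (hU t)).1 x
  have hderiv (v : ι →₀ ℂ) : HasDerivAt (fun t => U t (finiteParticle ι v))
      (finiteParticle ι (K v)) 0 := by
    have h := hasDerivAt_exp_smul hr (hA v)
    rw [pow_one] at h
    refine h.congr_of_eventuallyEq ?_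
    filter_upwards [hnear] with t ht
    rw [hUV t ht, (hV t (by linarith)).1, expSeries]
  have hU0 : U 0 = 1 := by rw [hUV 0 (by simpa using by linarith), hV0]
  -- Differentiability gives continuity on a dense subspace; an `ε/3` argument extends it because
  -- every `U t` is isometric.
  have hcont0 (x : lp (fun _ : ι => ℂ) 2) : ContinuousAt (fun t => U t x) 0 := by
    rw [Metric.continuousAt_iff]
    intro ε hε
    obtain ⟨v, hv⟩ := denseRange_finiteParticle.exists_dist_lt x (by linarith : 0 < ε / 3)
    obtain ⟨δ, hδ, h⟩ := Metric.continuousAt_iff.1 (hderiv v).continuousAt (ε / 3) (by linarith)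
    refine ⟨δ, hδ, fun t ht => ?_⟩
    have h1 := h ht
    have h2 (s : ℝ) : dist (U s x) (U s (finiteParticle ι v)) < ε / 3 := by
      rwa [dist_eq_norm, ← map_sub, hnorm, ← dist_eq_norm]
    have h3 := dist_triangle4_right (U t x) (U 0 x) (U t (finiteParticle ι v))
      (U 0 (finiteParticle ι v))
    have h4 := h2 t
    have h5 := h2 0
    linarith
  refine ⟨U, hU, hU0, hUadd, fun x => continuous_iff_continuousAt.2 fun t => ?_, hderiv⟩
  have h : (fun s => U s x) = fun s => U t (U (s - t) x) := by
    funext s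
    rw [← clm_mul_apply, ← hUadd, add_sub_cancel]
  rw [h]
  refine (U t).continuous.continuousAt.comp ?_
  refine ContinuousAt.comp (g := fun s => U s x) (f := fun s => s - t) ?_ (by fun_prop)
  rw [sub_self]
  exact hcont0 x

/-- A bounded weak solution of `f' = K f` on the half-line with `f 0 = 0` vanishes. -/
theorem IsAnalyticFor.eq_zero_of_weak {r C : ℝ} (hr : 0 < r) (hA : IsAnalyticFor K r)
    {f : ℝ → lp (fun _ : ι => ℂ) 2} (hC : ∀ t, ‖f t‖ ≤ C) (h0 : f 0 = 0)
    (hf : ∀ i t, HasDerivAt (fun s => f s i)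
      (-inner ℂ (finiteParticle ι (K (Finsupp.single i 1))) (f t)) t) (t : ℝ) (ht : 0 ≤ t) :
    f t = 0 := by
  have hC0 : 0 ≤ C := (norm_nonneg _).trans (hC 0)
  have hw (w : ι →₀ ℂ) (t : ℝ) : HasDerivAt (fun s => inner ℂ (finiteParticle ι w) (f s))
      (-inner ℂ (finiteParticle ι (K w)) (f t)) t := by
    induction w using Finsupp.induction_linear with
    | zero => simpa using hasDerivAt_const t (0 : ℂ)
    | add v w hv hw =>
      simp only [map_add, inner_add_left, neg_add]
      exact hv.add hw
    | single i c =>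
      have h := (hf i t).const_mul (conj c)
      have hc : Finsupp.single i c = c • Finsupp.single i (1 : ℂ) := by simp
      rw [hc]
      simp only [map_smul, inner_smul_left, finiteParticle_single, one_smul, inner_single_one]
      rwa [← mul_neg]
  -- Integrating `|⟨w, f⟩'| ≤ |⟨K w, f⟩|` repeatedly from `a`, where `f` vanishes, gives a Taylor
  -- bound whose only input is `‖f‖ ≤ C`. For `t - a ≤ r` analyticity sends it to `0`.
  have hstep (a : ℝ) (ha : f a = 0) (n : ℕ) : ∀ (w : ι →₀ ℂ), ∀ t ∈ Set.Icc a (a + r),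
      ‖inner ℂ (finiteParticle ι w) (f t)‖ ≤
        C * ((t - a) ^ n / n ! * ‖finiteParticle ι ((K ^ n) w)‖) := by
    induction n with
    | zero =>
      intro w t _
      have := norm_inner_le_norm (𝕜 := ℂ) (finiteParticle ι w) (f t)
      simp only [pow_zero, Nat.factorial_zero, Nat.cast_one, div_one, one_mul, Module.End.one_apply]
      refine this.trans ?_
      rw [mul_comm]
      gcongr
      exact hC t
    | succ n ih =>
      intro w
      refine image_norm_le_of_norm_deriv_right_le_deriv_boundary
        (f' := fun t => -inner ℂ (finiteParticle ι (K w)) (f t))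
        (B' := fun t => C * ((t - a) ^ n / n ! * ‖finiteParticle ι ((K ^ (n + 1)) w)‖))
        (fun t _ => (hw w t).continuousAt.continuousWithinAt)
        (fun t _ => (hw w t).hasDerivWithinAt) (by simp [ha]) (fun t => ?_) fun t ht => ?_
      · have h := ((((hasDerivAt_id t).sub_const a).pow (n + 1)).div_const ((n + 1)! : ℝ)).mul_const
          ‖finiteParticle ι ((K ^ (n + 1)) w)‖ |>.const_mul C
        refine h.congr_deriv ?_
        rw [Nat.factorial_succ]
        push_cast
        have : (n ! : ℝ) ≠ 0 := by positivity
        simp only [id, mul_one]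
        field_simp
      · rw [norm_neg, pow_succ, Module.End.mul_apply]
        exact ih (K w) t (Set.Ico_subset_Icc_self ht)
  have hinterval (a : ℝ) (ha : f a = 0) (t : ℝ) (ht : t ∈ Set.Icc a (a + r)) : f t = 0 := by
    ext i
    have hi : f t i = inner ℂ (finiteParticle ι (Finsupp.single i 1)) (f t) := by
      rw [finiteParticle_single, one_smul, inner_single_one]
    rw [hi]
    have hlim : Filter.Tendsto
        (fun n : ℕ => C * (r ^ n / n ! * ‖finiteParticle ι ((K ^ n) (Finsupp.single i 1))‖))
        Filter.atTop (nhds 0) := by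
      simpa using (hA (Finsupp.single i 1)).tendsto_atTop_zero.const_mul C
    refine norm_le_zero_iff.1 (ge_of_tendsto' hlim fun n => (hstep a ha n _ t ht).trans ?_)
    have h1 : 0 ≤ t - a := sub_nonneg.2 ht.1
    have h2 : t - a ≤ r := by linarith [ht.2]
    gcongr
  -- The vanishing propagates in steps of length `r`, since the radius is uniform over all vectors.
  have hgrid (n : ℕ) : f (n * r) = 0 := by
    induction n with
    | zero => simpa using h0
    | succ n ih =>
      refine hinterval _ ih _ ⟨?_, ?_⟩
      · gcongr
        simp
      · push_cast
        linarith
  have hfl := Nat.floor_le (div_nonneg ht hr.le)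
  have hlt := Nat.lt_floor_add_one (t / r)
  rw [le_div_iff₀ hr] at hfl
  rw [div_lt_iff₀ hr] at hlt
  exact hinterval _ (hgrid ⌊t / r⌋₊) t ⟨hfl, by linarith⟩

/-! ### Orbits of unitary groups and uniqueness of the group -/

theorem IsUnitaryGroup.norm_map {U : ℝ → lp (fun _ : ι => ℂ) 2 →L[ℂ] lp (fun _ : ι => ℂ) 2}
    (hU : IsUnitaryGroup K U) (t : ℝ) (x : lp (fun _ : ι => ℂ) 2) : ‖U t x‖ = ‖x‖ :=
  (ContinuousLinearMap.norm_map_iff_adjoint_comp_self (U t)).2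
    (Unitary.mem_iff.1 (hU.unitary t)).1 x

theorem IsUnitaryGroup.inner_map {U : ℝ → lp (fun _ : ι => ℂ) 2 →L[ℂ] lp (fun _ : ι => ℂ) 2}
    (hU : IsUnitaryGroup K U) (t : ℝ) (x y : lp (fun _ : ι => ℂ) 2) :
    inner ℂ (U t x) (U t y) = inner ℂ x y :=
  (LinearMap.norm_map_iff_inner_map_map (U t)).1 (hU.norm_map t) x y

theorem IsUnitaryGroup.inner_right {U : ℝ → lp (fun _ : ι => ℂ) 2 →L[ℂ] lp (fun _ : ι => ℂ) 2}
    (hU : IsUnitaryGroup K U) (t : ℝ) (x y : lp (fun _ : ι => ℂ) 2) :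
    inner ℂ x (U t y) = inner ℂ (U (-t) x) y := by
  rw [← hU.inner_map t (U (-t) x) y, ← clm_mul_apply, ← hU.map_add,
    add_neg_cancel, hU.map_zero]
  rfl

/-- The orbits of the unitary group are weak solutions of `f' = K f`. -/
theorem IsUnitaryGroup.hasDerivAt_apply
    {U : ℝ → lp (fun _ : ι => ℂ) 2 →L[ℂ] lp (fun _ : ι => ℂ) 2}
    (hU : IsUnitaryGroup K U) (x : lp (fun _ : ι => ℂ) 2) (i : ι) (t : ℝ) :
    HasDerivAt (fun s => U s x i)
      (-inner ℂ (finiteParticle ι (K (Finsupp.single i 1))) (U t x)) t := by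
  -- The time dependence is moved onto the basis vector, which lies in the domain of `K`, whereas
  -- `x` is arbitrary.
  have h1 : (fun s => U s x i) =
      fun s => inner ℂ (U (t - s) (finiteParticle ι (Finsupp.single i 1))) (U t x) := by
    funext s
    rw [show t - s = -(s - t) by ring, ← hU.inner_right, ← clm_mul_apply,
      ← hU.map_add, sub_add_cancel, finiteParticle_single, one_smul, inner_single_one]
  rw [h1]
  have h2 : HasDerivAt (fun s => U (t - s) (finiteParticle ι (Finsupp.single i 1)))
      (-finiteParticle ι (K (Finsupp.single i 1))) t := by
    have := hU.hasDerivAt (Finsupp.single i 1)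
    rw [← sub_self t] at this
    simpa using! this.scomp t ((hasDerivAt_id t).const_sub t)
  rw [← inner_neg_left]
  simpa using h2.inner ℂ (hasDerivAt_const t (U t x))

/-- A bounded weak solution of `f' = K f` is an orbit of the unitary group. -/
theorem IsUnitaryGroup.eq_of_weak {r C : ℝ} (hr : 0 < r) (hA : IsAnalyticFor K r)
    {U : ℝ → lp (fun _ : ι => ℂ) 2 →L[ℂ] lp (fun _ : ι => ℂ) 2} (hU : IsUnitaryGroup K U)
    {f : ℝ → lp (fun _ : ι => ℂ) 2} (hC : ∀ t, ‖f t‖ ≤ C)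
    (hf : ∀ i t, HasDerivAt (fun s => f s i)
      (-inner ℂ (finiteParticle ι (K (Finsupp.single i 1))) (f t)) t) {t : ℝ} (ht : 0 ≤ t) :
    U t (f 0) = f t := by
  refine (sub_eq_zero.1 (hA.eq_zero_of_weak (f := fun s => f s - U s (f 0)) (C := C + C) hr
    (fun s => ?_) ?_ (fun i s => ?_) t ht)).symm
  · refine (norm_sub_le _ _).trans (add_le_add (hC s) ?_)
    rw [hU.norm_map]
    exact hC 0
  · simp [hU.map_zero]
  · rw [inner_sub_right, neg_sub']
    exact (hf i s).sub (hU.hasDerivAt_apply (f 0) i s)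

/-- The orbits of one group are bounded weak solutions for the other, which settles `t ≥ 0`;
negative times follow by taking inverses. -/
theorem IsUnitaryGroup.unique {r : ℝ} (hr : 0 < r) (hA : IsAnalyticFor K r)
    {U U' : ℝ → lp (fun _ : ι => ℂ) 2 →L[ℂ] lp (fun _ : ι => ℂ) 2} (hU : IsUnitaryGroup K U)
    (hU' : IsUnitaryGroup K U') : U = U' := by
  have hpos (t : ℝ) (ht : 0 ≤ t) : U t = U' t := by
    ext1 x
    have h := hU.eq_of_weak hr hA (f := fun s => U' s x) (C := ‖x‖)
      (fun s => (hU'.norm_map s x).le) (hU'.hasDerivAt_apply x) ht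
    rwa [hU'.map_zero, one_apply_eq_self] at h
  funext t
  rcases le_total 0 t with ht | ht
  · exact hpos t ht
  · refine left_inv_eq_right_inv (a := U (-t)) ?_ ?_
    · rw [← hU.map_add, add_neg_cancel, hU.map_zero]
    · rw [hpos (-t) (by linarith), ← hU'.map_add, neg_add_cancel, hU'.map_zero]

theorem isUnitaryGroup_unitaryExp {r : ℝ} (hr : 0 < r) (hA : IsAnalyticFor K r) (hK : IsSkew K) :
    ∃ U : ℝ → lp (fun _ : ι => ℂ) 2 →L[ℂ] lp (fun _ : ι => ℂ) 2,
      IsUnitaryGroup K U ∧ unitaryExp K = U 1 := by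
  obtain ⟨U, hU⟩ := hA.exists_isUnitaryGroup hr hK
  have h : ∃! U : ℝ → lp (fun _ : ι => ℂ) 2 →L[ℂ] lp (fun _ : ι => ℂ) 2, IsUnitaryGroup K U :=
    ⟨U, hU, fun U' hU' => hU'.unique hr hA hU⟩
  refine ⟨h.choose, h.choose_spec.1, ?_⟩
  rw [unitaryExp, dif_pos h]

theorem unitaryExp_mem_unitary {r : ℝ} (hr : 0 < r) (hA : IsAnalyticFor K r) (hK : IsSkew K) :
    unitaryExp K ∈ unitary (lp (fun _ : ι => ℂ) 2 →L[ℂ] lp (fun _ : ι => ℂ) 2) := by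
  obtain ⟨U, hU, h⟩ := isUnitaryGroup_unitaryExp hr hA hK
  exact h ▸ hU.unitary 1

/-- `exp K` maps the initial value of a bounded weak solution of `f' = K f` to its value at
time `1`. -/
theorem unitaryExp_apply_of_weak {r C : ℝ} (hr : 0 < r) (hA : IsAnalyticFor K r) (hK : IsSkew K)
    {f : ℝ → lp (fun _ : ι => ℂ) 2} (hC : ∀ t, ‖f t‖ ≤ C)
    (hf : ∀ i t, HasDerivAt (fun s => f s i)
      (-inner ℂ (finiteParticle ι (K (Finsupp.single i 1))) (f t)) t) :
    unitaryExp K (f 0) = f 1 := by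
  obtain ⟨U, hU, h⟩ := isUnitaryGroup_unitaryExp hr hA hK
  rw [h]
  exact hU.eq_of_weak hr hA hC hf zero_le_one

/-- An operator that is a sum of two weighted shifts, both of which raise a degree function by at
most `1` and have weights bounded linearly in the degree, has analytic vectors. -/
theorem isAnalyticFor_of_shifts {d : ι → ℕ} {σ τ : ι → ι} {A B : ι → ℂ} {c : ℝ} (hc : 0 < c)
    (hK : ∀ i, K (Finsupp.single i 1) =
      A i • Finsupp.single (σ i) 1 + B i • Finsupp.single (τ i) 1)
    (hσ : ∀ i, d (σ i) ≤ d i + 1) (hτ : ∀ i, d (τ i) ≤ d i + 1)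
    (hA : ∀ i, ‖A i‖ ≤ c * (d i + 1)) (hB : ∀ i, ‖B i‖ ≤ c * (d i + 1)) :
    IsAnalyticFor K (1 / (8 * c)) := by
  -- Each application of `K` doubles the number of terms, costs a factor `c (d + 1)` and raises the
  -- degree by at most one.
  have hpow (n : ℕ) : ∀ i, ‖finiteParticle ι ((K ^ n) (Finsupp.single i 1))‖ ≤
      (2 * c) ^ n * (d i + 1).ascFactorial n := by
    induction n with
    | zero =>
      intro i
      have : ‖lp.single (E := fun _ : ι => ℂ) 2 i (1 : ℂ)‖ = 1 := by
        rw [lp.norm_single (by norm_num), norm_one]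
      simp [finiteParticle_single, this]
    | succ n ih =>
      intro i
      have hmono (j : ι) (hj : d j ≤ d i + 1) :
          ‖finiteParticle ι ((K ^ n) (Finsupp.single j 1))‖ ≤
            (2 * c) ^ n * (d i + 1 + 1).ascFactorial n := by
        refine (ih j).trans ?_
        have : (d j + 1).ascFactorial n ≤ (d i + 1 + 1).ascFactorial n :=
          Nat.ascFactorial_le n (by omega)
        gcongr
      rw [pow_succ, Module.End.mul_apply, hK, map_add, map_smul, map_smul, map_add, map_smul,
        map_smul]
      have hid : ((d i + 1 : ℕ) : ℝ) * (d i + 1 + 1).ascFactorial n =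
          (d i + 1).ascFactorial (n + 1) := by
        rw [Nat.ascFactorial_succ]
        exact_mod_cast Nat.succ_ascFactorial (d i + 1) n
      refine (norm_add_le _ _).trans ?_
      rw [norm_smul, norm_smul]
      calc _ ≤ c * (d i + 1) * ((2 * c) ^ n * (d i + 1 + 1).ascFactorial n) +
            c * (d i + 1) * ((2 * c) ^ n * (d i + 1 + 1).ascFactorial n) := by
            gcongr
            · exact hA i
            · exact hmono _ (hσ i)
            · exact hB i
            · exact hmono _ (hτ i)
        _ = (2 * c) ^ (n + 1) * (((d i + 1 : ℕ) : ℝ) * (d i + 1 + 1).ascFactorial n) := by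
            push_cast
            ring
        _ = _ := by rw [hid]
  intro v
  induction v using Finsupp.induction_linear with
  | zero => simp
  | add v w hv hw =>
    refine (hv.add hw).of_nonneg_of_le (fun n => by positivity) fun n => ?_
    rw [map_add, map_add, ← mul_add]
    gcongr
    exact norm_add_le _ _
  | single i a =>
    -- The ratio: `1/(8c)` from the radius, `2c` from `hpow`, and `2` from `choose (d+n) n ≤
    -- 2^(d+n)`, with product `1/2`.
    have hs : Summable fun n : ℕ => ‖a‖ * 2 ^ d i * (1 / 2 : ℝ) ^ n :=
      (summable_geometric_of_lt_one (by norm_num) (by norm_num)).mul_left _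
    refine hs.of_nonneg_of_le (fun n => by positivity) fun n => ?_
    have ha : Finsupp.single i a = a • Finsupp.single i (1 : ℂ) := by simp
    rw [ha, map_smul, map_smul, norm_smul]
    have h1 := hpow n i
    rw [Nat.ascFactorial_eq_factorial_mul_choose] at h1
    have h2 : ((d i + n).choose n : ℝ) ≤ 2 ^ (d i + n) := by
      exact_mod_cast Nat.choose_le_two_pow _ _
    have h3 : (0 : ℝ) < n ! := by positivity
    calc (1 / (8 * c)) ^ n / n ! * (‖a‖ * ‖finiteParticle ι ((K ^ n) (Finsupp.single i 1))‖)
        ≤ (1 / (8 * c)) ^ n / n ! * (‖a‖ * ((2 * c) ^ n * ((n ! * (d i + n).choose n : ℕ) : ℝ))) := by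
          gcongr
      _ ≤ (1 / (8 * c)) ^ n / n ! * (‖a‖ * ((2 * c) ^ n * (n ! * 2 ^ (d i + n)))) := by
          push_cast
          gcongr
      _ = ‖a‖ * 2 ^ d i * ((1 / (8 * c)) ^ n * (2 * c) ^ n * 2 ^ n) * (n ! / n !) := by
          rw [pow_add]
          ring
      _ = _ := by
          rw [← mul_pow, ← mul_pow, div_self h3.ne', mul_one]
          congr 2
          field_simp
          norm_num

end Nelson

/-! ### The generators of displacements, squeezing and beamsplitters -/

section Adjoint

variable {ι : Type} [DecidableEq ι]

/-- `A` and `B` are formal adjoints of one another on the finite-particle vectors. -/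
def IsFormalAdjoint (A B : Module.End ℂ (ι →₀ ℂ)) : Prop :=
  ∀ v w, inner ℂ (finiteParticle ι (A v)) (finiteParticle ι w) =
    inner ℂ (finiteParticle ι v) (finiteParticle ι (B w))

variable {A B A' B' : Module.End ℂ (ι →₀ ℂ)}

theorem IsFormalAdjoint.of_single
    (h : ∀ i j, inner ℂ (finiteParticle ι (A (Finsupp.single i 1))) (lp.single 2 j (1 : ℂ)) =
      inner ℂ (lp.single 2 i (1 : ℂ)) (finiteParticle ι (B (Finsupp.single j 1)))) :
    IsFormalAdjoint A B := by
  intro v w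
  induction v using Finsupp.induction_linear with
  | zero => simp
  | add v v' hv hv' => simp only [map_add, inner_add_left, hv, hv']
  | single i a =>
    induction w using Finsupp.induction_linear with
    | zero => simp
    | add w w' hw hw' => simp only [map_add, inner_add_right, hw, hw']
    | single j b =>
      have ha : Finsupp.single i a = a • Finsupp.single i (1 : ℂ) := by simp
      have hb : Finsupp.single j b = b • Finsupp.single j (1 : ℂ) := by simp
      rw [ha, hb]
      simp only [map_smul, inner_smul_left, inner_smul_right, finiteParticle_single, one_smul, h]

theorem IsFormalAdjoint.symm (h : IsFormalAdjoint A B) : IsFormalAdjoint B A := fun v w => by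
  rw [← inner_conj_symm, ← h w v, inner_conj_symm]

theorem IsFormalAdjoint.mul (h : IsFormalAdjoint A B) (h' : IsFormalAdjoint A' B') :
    IsFormalAdjoint (A * A') (B' * B) := fun v w => by
  rw [Module.End.mul_apply, h, h', Module.End.mul_apply]

theorem IsFormalAdjoint.smul (h : IsFormalAdjoint A B) (c : ℂ) :
    IsFormalAdjoint (c • A) (conj c • B) := fun v w => by
  simp only [LinearMap.smul_apply, map_smul, inner_smul_left, inner_smul_right, h v w]

theorem IsFormalAdjoint.isSkew_sub (h : IsFormalAdjoint A B) : IsSkew (A - B) := fun v w => by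
  simp only [LinearMap.sub_apply, map_sub, inner_sub_left, inner_sub_right, h v w, h.symm v w,
    neg_sub]

theorem IsSkew.real_smul (h : IsSkew A) (r : ℝ) : IsSkew ((r : ℂ) • A) := fun v w => by
  simp only [LinearMap.smul_apply, map_smul, inner_smul_left, inner_smul_right, h v w,
    Complex.conj_ofReal, mul_neg]

end Adjoint

/-! ### Ladder operators on Fock states -/

theorem create_single (n : ℕ) : create (Finsupp.single n 1) =
    ((√((n : ℝ) + 1) : ℝ) : ℂ) • Finsupp.single (n + 1) 1 := by
  simp [create]

theorem annihilate_single (n : ℕ) : annihilate (Finsupp.single n 1) =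
    ((√(n : ℝ) : ℝ) : ℂ) • Finsupp.single (n - 1) 1 := by
  simp [annihilate]

theorem createFst_single (p : ℕ × ℕ) : createFst (Finsupp.single p 1) =
    ((√((p.1 : ℝ) + 1) : ℝ) : ℂ) • Finsupp.single (p.1 + 1, p.2) 1 := by
  simp [createFst]

theorem createSnd_single (p : ℕ × ℕ) : createSnd (Finsupp.single p 1) =
    ((√((p.2 : ℝ) + 1) : ℝ) : ℂ) • Finsupp.single (p.1, p.2 + 1) 1 := by
  simp [createSnd]

theorem annihilateFst_single (p : ℕ × ℕ) : annihilateFst (Finsupp.single p 1) =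
    ((√(p.1 : ℝ) : ℝ) : ℂ) • Finsupp.single (p.1 - 1, p.2) 1 := by
  simp [annihilateFst]

theorem annihilateSnd_single (p : ℕ × ℕ) : annihilateSnd (Finsupp.single p 1) =
    ((√(p.2 : ℝ) : ℝ) : ℂ) • Finsupp.single (p.1, p.2 - 1) 1 := by
  simp [annihilateSnd]

theorem isFormalAdjoint_create : IsFormalAdjoint create annihilate := by
  refine .of_single fun i j => ?_
  rw [create_single, annihilate_single]
  simp only [map_smul, finiteParticle_single, one_smul, inner_smul_left, inner_smul_right,
    inner_single_one, lp.single_apply, Complex.conj_ofReal]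
  -- At `j = 0` the index `j - 1` is truncated, which is harmless because the weight `√0` vanishes.
  rcases j with _ | j
  · simp
  · simp [Pi.single_apply]
    grind

theorem isFormalAdjoint_createFst : IsFormalAdjoint createFst annihilateFst := by
  refine .of_single fun i j => ?_
  rw [createFst_single, annihilateFst_single]
  simp only [map_smul, finiteParticle_single, one_smul, inner_smul_left, inner_smul_right,
    inner_single_one, lp.single_apply, Complex.conj_ofReal]
  obtain ⟨i, i'⟩ := i
  obtain ⟨_ | j, j'⟩ := j
  · simp
  · simp [Pi.single_apply]
    grind

theorem isFormalAdjoint_createSnd : IsFormalAdjoint createSnd annihilateSnd := by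
  refine .of_single fun i j => ?_
  rw [createSnd_single, annihilateSnd_single]
  simp only [map_smul, finiteParticle_single, one_smul, inner_smul_left, inner_smul_right,
    inner_single_one, lp.single_apply, Complex.conj_ofReal]
  obtain ⟨i, i'⟩ := i
  obtain ⟨j, _ | j'⟩ := j
  · simp
  · simp [Pi.single_apply]
    grind

theorem end_ext {ι : Type} {A B : Module.End ℂ (ι →₀ ℂ)}
    (h : ∀ i, A (Finsupp.single i 1) = B (Finsupp.single i 1)) : A = B := by
  ext1 i
  exact LinearMap.ext_ring (h i)

/-- The formal adjoint of `a† b†` comes out as `b a`; the generator is written with `a b`. -/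
theorem annihilateSnd_mul_annihilateFst :
    annihilateSnd * annihilateFst = annihilateFst * annihilateSnd := end_ext fun p => by
  simp only [Module.End.mul_apply, annihilateFst_single, annihilateSnd_single, map_smul]
  rw [smul_comm]

theorem createSnd_mul_annihilateFst :
    createSnd * annihilateFst = annihilateFst * createSnd := end_ext fun p => by
  simp only [Module.End.mul_apply, annihilateFst_single, createSnd_single, map_smul]
  rw [smul_comm]

theorem isSkew_displacement (β : ℂ) : IsSkew (β • create - conj β • annihilate) :=
  (isFormalAdjoint_create.smul β).isSkew_sub

theorem isSkew_squeezing (r : ℝ) :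
    IsSkew ((r : ℂ) • (createFst * createSnd - annihilateFst * annihilateSnd)) := by
  have h := (isFormalAdjoint_createFst.mul isFormalAdjoint_createSnd).isSkew_sub.real_smul r
  rwa [annihilateSnd_mul_annihilateFst] at h

theorem isSkew_beamsplitter (r : ℝ) :
    IsSkew ((r : ℂ) • (createFst * annihilateSnd - annihilateFst * createSnd)) := by
  have h := (isFormalAdjoint_createFst.mul isFormalAdjoint_createSnd.symm).isSkew_sub.real_smul r
  rwa [createSnd_mul_annihilateFst] at h

theorem displacement_generator_single (β : ℂ) (n : ℕ) :
    (β • create - conj β • annihilate) (Finsupp.single n 1) =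
      (β * (√((n : ℝ) + 1) : ℝ)) • Finsupp.single (n + 1) 1 +
        (-(conj β * (√(n : ℝ) : ℝ))) • Finsupp.single (n - 1) 1 := by
  simp only [LinearMap.sub_apply, LinearMap.smul_apply, create_single, annihilate_single]
  module

theorem squeezing_generator_single (r : ℝ) (p : ℕ × ℕ) :
    ((r : ℂ) • (createFst * createSnd - annihilateFst * annihilateSnd)) (Finsupp.single p 1) =
      ((r * (√((p.1 : ℝ) + 1) * √((p.2 : ℝ) + 1)) : ℝ) : ℂ) •
          Finsupp.single (p.1 + 1, p.2 + 1) 1 +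
        ((-(r * (√(p.1 : ℝ) * √(p.2 : ℝ))) : ℝ) : ℂ) • Finsupp.single (p.1 - 1, p.2 - 1) 1 := by
  simp only [LinearMap.sub_apply, LinearMap.smul_apply, Module.End.mul_apply, createFst_single,
    createSnd_single, annihilateFst_single, annihilateSnd_single, map_smul]
  push_cast
  module

theorem beamsplitter_generator_single (r : ℝ) (p : ℕ × ℕ) :
    ((r : ℂ) • (createFst * annihilateSnd - annihilateFst * createSnd)) (Finsupp.single p 1) =
      ((r * (√((p.1 : ℝ) + 1) * √(p.2 : ℝ)) : ℝ) : ℂ) • Finsupp.single (p.1 + 1, p.2 - 1) 1 +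
        ((-(r * (√(p.1 : ℝ) * √((p.2 : ℝ) + 1))) : ℝ) : ℂ) •
          Finsupp.single (p.1 - 1, p.2 + 1) 1 := by
  simp only [LinearMap.sub_apply, LinearMap.smul_apply, Module.End.mul_apply, createFst_single,
    createSnd_single, annihilateFst_single, annihilateSnd_single, map_smul]
  push_cast
  module

theorem neg_inner_shifts {ι : Type} [DecidableEq ι] {K : Module.End ℂ (ι →₀ ℂ)} {i j k : ι}
    {a b : ℂ} (h : K (Finsupp.single i 1) = a • Finsupp.single j 1 + b • Finsupp.single k 1)
    (x : lp (fun _ : ι => ℂ) 2) :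
    -inner ℂ (finiteParticle ι (K (Finsupp.single i 1))) x = -(conj a * x j + conj b * x k) := by
  rw [h]
  simp only [map_add, map_smul, finiteParticle_single, one_smul, inner_add_left, inner_smul_left,
    inner_single_one]

/-! ### Linear growth of the weights and analytic vectors -/

theorem sqrt_mul_sqrt_le {x y d : ℝ} (hd : 0 ≤ d) (hx : x ≤ d) (hy : y ≤ d) : √x * √y ≤ d := by
  calc √x * √y ≤ √d * √d := by gcongr
    _ = d := Real.mul_self_sqrt hd

theorem sqrt_le_add_one {x d : ℝ} (hd : 0 ≤ d) (hx : x ≤ d + 1) : √x ≤ d + 1 := by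
  rw [Real.sqrt_le_left (by linarith)]
  nlinarith

theorem isAnalyticFor_displacement (β : ℂ) :
    IsAnalyticFor (β • create - conj β • annihilate) (1 / (8 * (‖β‖ + 1))) := by
  refine isAnalyticFor_of_shifts (d := id) (by positivity) (displacement_generator_single β)
    (fun n => le_rfl) (fun n => (Nat.sub_le _ _).trans (Nat.le_succ _)) (fun n => ?_) fun n => ?_
  · rw [norm_mul, Complex.norm_real, Real.norm_of_nonneg (Real.sqrt_nonneg _)]
    exact mul_le_mul (by linarith) (sqrt_le_add_one (Nat.cast_nonneg _) le_rfl)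
      (Real.sqrt_nonneg _) (by positivity)
  · rw [norm_neg, norm_mul, Complex.norm_real, Real.norm_of_nonneg (Real.sqrt_nonneg _),
      RCLike.norm_conj]
    exact mul_le_mul (by linarith) (sqrt_le_add_one (Nat.cast_nonneg _) (by simp))
      (Real.sqrt_nonneg _) (by positivity)

theorem norm_real_mul_sqrt_le {r x y : ℝ} {p : ℕ × ℕ} (hx : x ≤ p.1 + 1) (hy : y ≤ p.2 + 1) :
    ‖((r * (√x * √y) : ℝ) : ℂ)‖ ≤ (|r| + 1) * ((max p.1 p.2 : ℕ) + 1) := by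
  rw [Complex.norm_real, norm_mul, Real.norm_eq_abs,
    Real.norm_of_nonneg (mul_nonneg (Real.sqrt_nonneg _) (Real.sqrt_nonneg _))]
  have h1 : (p.1 : ℝ) ≤ (max p.1 p.2 : ℕ) := by exact_mod_cast le_max_left _ _
  have h2 : (p.2 : ℝ) ≤ (max p.1 p.2 : ℕ) := by exact_mod_cast le_max_right _ _
  exact mul_le_mul (by linarith) (sqrt_mul_sqrt_le (by positivity) (by linarith) (by linarith))
    (mul_nonneg (Real.sqrt_nonneg _) (Real.sqrt_nonneg _)) (by positivity)

/-- The degree is the larger occupation number, not the total one, which `a† b†` raises by two. The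
`+ 1` in `|r| + 1` keeps the constant positive at `r = 0`. -/
theorem isAnalyticFor_squeezing (r : ℝ) :
    IsAnalyticFor ((r : ℂ) • (createFst * createSnd - annihilateFst * annihilateSnd))
      (1 / (8 * (|r| + 1))) := by
  refine isAnalyticFor_of_shifts (d := fun p => max p.1 p.2) (by positivity)
    (squeezing_generator_single r) (fun p => ?_) (fun p => ?_) (fun p => ?_) fun p => ?_
  · grind
  · grind
  · exact norm_real_mul_sqrt_le le_rfl le_rfl
  · rw [Complex.ofReal_neg, norm_neg]
    exact norm_real_mul_sqrt_le (by simp) (by simp)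

theorem isAnalyticFor_beamsplitter (r : ℝ) :
    IsAnalyticFor ((r : ℂ) • (createFst * annihilateSnd - annihilateFst * createSnd))
      (1 / (8 * (|r| + 1))) := by
  refine isAnalyticFor_of_shifts (d := fun p => max p.1 p.2) (by positivity)
    (beamsplitter_generator_single r) (fun p => ?_) (fun p => ?_) (fun p => ?_) fun p => ?_
  · grind
  · grind
  · exact norm_real_mul_sqrt_le le_rfl (by simp)
  · rw [Complex.ofReal_neg, norm_neg]
    exact norm_real_mul_sqrt_le (by simp) le_rfl

/-! ### Exponential vectors -/

/-- The unnormalised coherent state `∑ₙ zⁿ/√(n!) |n⟩`. -/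
def expVec (z : ℂ) : Mode := (Real.exp (‖z‖ ^ 2 / 2) : ℂ) • coherent z

theorem expVec_apply (z : ℂ) (n : ℕ) : expVec z n = z ^ n / (√(n ! : ℝ) : ℝ) := by
  have h : expVec z n = (Real.exp (‖z‖ ^ 2 / 2) : ℂ) * coherent z n := rfl
  rw [h, coherent_apply, ← mul_assoc, ← Complex.ofReal_mul, ← Real.exp_add, neg_div,
    add_neg_cancel, Real.exp_zero, Complex.ofReal_one, one_mul]

theorem norm_expVec (z : ℂ) : ‖expVec z‖ = Real.exp (‖z‖ ^ 2 / 2) := by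
  rw [expVec, norm_smul, norm_coherent, mul_one, Complex.norm_real,
    Real.norm_of_nonneg (Real.exp_pos _).le]

theorem coherent_eq_smul_expVec (z : ℂ) :
    coherent z = (Real.exp (-‖z‖ ^ 2 / 2) : ℂ) • expVec z := by
  rw [expVec, smul_smul, ← Complex.ofReal_mul, ← Real.exp_add, neg_div, neg_add_cancel,
    Real.exp_zero, Complex.ofReal_one, one_smul]

theorem expVec_zero : expVec 0 = fock 0 := by
  ext n
  rw [expVec_apply, fock, lp.single_apply]
  rcases n with _ | n <;> simp

/-- This is `d/dz e_z = a† e_z` in coordinates. With the eigenvalue equation `mul_expVec_apply` it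
reduces the weak equations along curves of exponential vectors to algebra. -/
theorem hasDerivAt_expVec_apply (n : ℕ) (z : ℂ) :
    HasDerivAt (fun z => expVec z n) ((√(n : ℝ) : ℝ) * expVec z (n - 1)) z := by
  simp only [expVec_apply]
  refine ((hasDerivAt_pow n z).div_const _).congr_deriv ?_
  rcases n with _ | n
  · simp
  · rw [Nat.add_sub_cancel, Nat.factorial_succ, Nat.cast_mul, Real.sqrt_mul (by positivity)]
    have h1 : (√((n + 1 : ℕ) : ℝ) : ℂ) ≠ 0 := by
      rw [Complex.ofReal_ne_zero]
      positivity
    have h2 : (√(n ! : ℝ) : ℂ) ≠ 0 := by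
      rw [Complex.ofReal_ne_zero]
      positivity
    have h3 : (√((n + 1 : ℕ) : ℝ) : ℂ) * (√((n + 1 : ℕ) : ℝ) : ℂ) = ((n + 1 : ℕ) : ℂ) := by
      rw [← Complex.ofReal_mul, Real.mul_self_sqrt (by positivity)]
      simp
    push_cast [-Nat.cast_add, -Nat.cast_succ]
    rw [← h3]
    field_simp

theorem mul_expVec_apply (z : ℂ) (n : ℕ) :
    z * expVec z n = (√((n : ℝ) + 1) : ℝ) * expVec z (n + 1) := by
  have h := coherent_eigen z n
  have h1 (k : ℕ) : expVec z k = (Real.exp (‖z‖ ^ 2 / 2) : ℂ) * coherent z k := rfl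
  rw [h1, h1]
  linear_combination (-(Real.exp (‖z‖ ^ 2 / 2) : ℂ)) * h

theorem inner_expVec_expVec (z w : ℂ) :
    inner ℂ (expVec z) (expVec w) = Complex.exp (conj z * w) := by
  rw [lp.inner_eq_tsum, Complex.exp_eq_exp_ℂ,
    ← (NormedSpace.expSeries_div_hasSum_exp (conj z * w)).tsum_eq]
  refine tsum_congr fun n => ?_
  rw [RCLike.inner_apply, expVec_apply, expVec_apply, map_div₀, map_pow, Complex.conj_ofReal,
    mul_comm, div_mul_div_comm, mul_pow, ← Complex.ofReal_mul, Real.mul_self_sqrt (by positivity)]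
  simp

theorem norm_tmul (x y : Mode) : ‖tmul x y‖ = ‖x‖ * ‖y‖ := by
  have h := inner_tmul_tmul x y x y
  rw [inner_self_eq_norm_sq_to_K, inner_self_eq_norm_sq_to_K, inner_self_eq_norm_sq_to_K] at h
  have h' : ‖tmul x y‖ ^ 2 = (‖x‖ * ‖y‖) ^ 2 := by
    rw [mul_pow]
    exact_mod_cast h
  exact (pow_left_inj₀ (norm_nonneg _) (by positivity) two_ne_zero).1 h'

/-! ### Displacements of exponential vectors -/

/-- The curve `e t • expVec (z + t β)` solves the weak equation; the scalar `e` is the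
Baker–Campbell–Hausdorff factor, which also keeps the norm constant. -/
theorem displacement_expVec (β z : ℂ) :
    displacement β (expVec z) =
      Complex.exp (-(β * conj β) / 2 - conj β * z) • expVec (z + β) := by
  set e : ℂ → ℂ := fun s => Complex.exp (-(s ^ 2 * (β * conj β)) / 2 - s * (conj β * z)) with he
  have h := unitaryExp_apply_of_weak (by positivity) (isAnalyticFor_displacement β)
    (isSkew_displacement β) (f := fun t : ℝ => e t • expVec (z + t * β))
    (C := Real.exp (‖z‖ ^ 2 / 2)) (fun t => ?_) fun n t => ?_
  · have h0 : e 0 = 1 := by simp [he]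
    simp only [Complex.ofReal_zero, zero_mul, add_zero, Complex.ofReal_one, one_mul, h0,
      one_smul] at h
    rw [displacement, h]
    simp [he]
  · rw [norm_smul, norm_expVec, Complex.norm_exp, ← Real.exp_add, ← Complex.normSq_eq_norm_sq,
      ← Complex.normSq_eq_norm_sq]
    refine (congrArg Real.exp ?_).le
    simp [Complex.normSq_apply, pow_two]
    ring
  · rw [neg_inner_shifts (displacement_generator_single β n)]
    -- The derivative is taken in complex time, where `expVec` is holomorphic in each coordinate,
    -- and then restricted to real time.
    have hd : HasDerivAt (fun s : ℂ => e s * expVec (z + s * β) n)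
        (e t * (-(t * (β * conj β)) - conj β * z) * expVec (z + t * β) n +
          e t * ((√(n : ℝ) : ℝ) * expVec (z + t * β) (n - 1) * β)) (t : ℂ) := by
      refine HasDerivAt.mul ?_ ?_
      · refine HasDerivAt.cexp ?_
        refine ((((((hasDerivAt_id (t : ℂ)).pow 2).mul_const (β * conj β)).neg.div_const 2).sub
          ((hasDerivAt_id (t : ℂ)).mul_const (conj β * z)))).congr_deriv ?_
        simp
        ring
      · have h1 := hasDerivAt_expVec_apply n (z + t * β)
        have h2 : HasDerivAt (fun s : ℂ => z + s * β) β (t : ℂ) := by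
          simpa using! ((hasDerivAt_id (t : ℂ)).mul_const β).const_add z
        exact h1.comp (t : ℂ) h2
    refine hd.comp_ofReal.congr_deriv ?_
    have hm := mul_expVec_apply (z + t * β) n
    change _ = -(conj (β * (√((n : ℝ) + 1) : ℝ)) * (e t * expVec (z + t * β) (n + 1)) +
      conj (-(conj β * (√(n : ℝ) : ℝ))) * (e t * expVec (z + t * β) (n - 1)))
    simp only [map_mul, map_neg, Complex.conj_conj, Complex.conj_ofReal]
    linear_combination (-conj β * e t) * hm

theorem adjoint_displacement_expVec (β z : ℂ) :
    ContinuousLinearMap.adjoint (displacement β) (expVec z) =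
      Complex.exp (-(β * conj β) / 2 + conj β * z) • expVec (z - β) := by
  have hu := unitaryExp_mem_unitary (by positivity) (isAnalyticFor_displacement β)
    (isSkew_displacement β)
  have h1 : ContinuousLinearMap.adjoint (displacement β) ∘L displacement β = 1 :=
    (Unitary.mem_iff.1 hu).1
  have h2 : expVec z = Complex.exp (-(β * conj β) / 2 + conj β * z) •
      displacement β (expVec (z - β)) := by
    rw [displacement_expVec, smul_smul, ← Complex.exp_add, sub_add_cancel]
    have : -(β * conj β) / 2 + conj β * z + (-(β * conj β) / 2 - conj β * (z - β)) = 0 := by ring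
    rw [this, Complex.exp_zero, one_smul]
  conv_lhs => rw [h2]
  rw [map_smul, ← ContinuousLinearMap.comp_apply, h1]
  rfl

theorem parity_expVec (z : ℂ) : parity (expVec z) = expVec (-z) := by
  ext n
  rw [parity_apply, expVec_apply, expVec_apply, neg_pow z, mul_div_assoc]

/-- Shift by `-β`, reflect, shift back: the point reflection `z ↦ 2β - z` of phase space. -/
theorem displacedParity_expVec (β z : ℂ) :
    displacedParity β (expVec z) =
      (2 * Complex.exp (-2 * (β * conj β) + 2 * conj β * z)) • expVec (2 * β - z) := by
  rw [displacedParity, smul_apply, ContinuousLinearMap.comp_apply,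
    ContinuousLinearMap.comp_apply, adjoint_displacement_expVec, map_smul, map_smul,
    parity_expVec, displacement_expVec, smul_smul, smul_smul, mul_assoc, ← Complex.exp_add]
  congr 3 <;> ring

/-! ### Beamsplitters acting on exponential vectors -/

/-- The generator rotates the pair of amplitudes, `(z, 0)` going to `(z cos, -z sin)`; the norm is
constant by `cos² + sin² = 1`. -/
theorem unitaryExp_beamsplitter_expVec (r : ℝ) (z : ℂ) :
    unitaryExp ((r : ℂ) • (createFst * annihilateSnd - annihilateFst * createSnd))
      (tmul (expVec z) (fock 0)) =
        tmul (expVec (z * Complex.cos r)) (expVec (-(z * Complex.sin r))) := by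
  have h := unitaryExp_apply_of_weak (by positivity) (isAnalyticFor_beamsplitter r)
    (isSkew_beamsplitter r)
    (f := fun t : ℝ => tmul (expVec (z * Complex.cos (t * r))) (expVec (-(z * Complex.sin (t * r)))))
    (C := Real.exp (‖z‖ ^ 2 / 2)) (fun t => ?_) fun p t => ?_
  · simpa [expVec_zero] using h
  · rw [norm_tmul, norm_expVec, norm_expVec, ← Real.exp_add, norm_neg, norm_mul, norm_mul,
      ← Complex.ofReal_mul, ← Complex.ofReal_cos, ← Complex.ofReal_sin, Complex.norm_real,
      Complex.norm_real, Real.norm_eq_abs, Real.norm_eq_abs, mul_pow, mul_pow, sq_abs, sq_abs]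
    refine (congrArg Real.exp ?_).le
    linear_combination ‖z‖ ^ 2 / 2 * Real.cos_sq_add_sin_sq (t * r)
  · rw [neg_inner_shifts (beamsplitter_generator_single r p)]
    have hl : HasDerivAt (fun s : ℂ => s * r) r (t : ℂ) := by
      simpa using! (hasDerivAt_id (t : ℂ)).mul_const (r : ℂ)
    have hc : HasDerivAt (fun s : ℂ => z * Complex.cos (s * r))
        (z * (-Complex.sin (t * r) * r)) (t : ℂ) := hl.ccos.const_mul z
    have hs : HasDerivAt (fun s : ℂ => -(z * Complex.sin (s * r)))
        (-(z * (Complex.cos (t * r) * r))) (t : ℂ) := (hl.csin.const_mul z).neg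
    have hd := ((hasDerivAt_expVec_apply p.1 _).comp (t : ℂ) hc).mul
      ((hasDerivAt_expVec_apply p.2 _).comp (t : ℂ) hs)
    refine hd.comp_ofReal.congr_deriv ?_
    have hm1 := mul_expVec_apply (z * Complex.cos (t * r)) p.1
    have hm2 := mul_expVec_apply (-(z * Complex.sin (t * r))) p.2
    simp only [Complex.conj_ofReal, tmul_apply, Function.comp_apply]
    push_cast
    linear_combination
      (r * (√(p.1 : ℝ) : ℝ) * expVec (z * Complex.cos (t * r)) (p.1 - 1)) * hm2 -
      (r * (√(p.2 : ℝ) : ℝ) * expVec (-(z * Complex.sin (t * r))) (p.2 - 1)) * hm1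

/-! ### Two-mode squeezing of Fock states -/

/-- The Fock coefficients of the two-mode squeezed state `S(t) |n, 0⟩`. -/
def squeezedCoeff (n : ℕ) (t : ℝ) (p : ℕ × ℕ) : ℝ :=
  if p.1 = n + p.2 then
    √(p.1.choose p.2 : ℝ) * Real.sinh t ^ p.2 / Real.cosh t ^ (p.1 + 1) else 0

theorem squeezedCoeff_diag (n k : ℕ) (t : ℝ) :
    squeezedCoeff n t (n + k, k) =
      √((n + k).choose k : ℝ) * Real.sinh t ^ k / Real.cosh t ^ (n + k + 1) := if_pos rfl

theorem squeezedCoeff_of_ne {n : ℕ} {p : ℕ × ℕ} (h : p.1 ≠ n + p.2) (t : ℝ) :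
    squeezedCoeff n t p = 0 := if_neg h

/-- The negative binomial series in `tanh² t`, with `1 - tanh² = 1/cosh²`. -/
theorem hasSum_squeezedCoeff_sq (n : ℕ) (t : ℝ) :
    HasSum (fun p => squeezedCoeff n t p ^ 2) 1 := by
  have hinj : Function.Injective fun k : ℕ => (n + k, k) := fun k l h => (Prod.ext_iff.1 h).2
  refine (hinj.hasSum_iff fun p hp => ?_).1 ?_
  · rw [squeezedCoeff_of_ne, zero_pow two_ne_zero]
    exact fun h => hp ⟨p.2, Prod.ext h.symm rfl⟩
  · have hc := Real.cosh_pos t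
    have hr : 1 - Real.sinh t ^ 2 / Real.cosh t ^ 2 = 1 / Real.cosh t ^ 2 := by
      rw [Real.cosh_sq' t]
      have : (1 + Real.sinh t ^ 2) ≠ 0 := by positivity
      field_simp
      ring
    have hlt : ‖Real.sinh t ^ 2 / Real.cosh t ^ 2‖ < 1 := by
      rw [Real.norm_of_nonneg (by positivity)]
      have : 0 < 1 / Real.cosh t ^ 2 := by positivity
      linarith
    have h := (hasSum_choose_mul_geometric_of_norm_lt_one n hlt).mul_left
      ((1 / Real.cosh t ^ 2) ^ (n + 1))
    rw [hr, mul_one_div_cancel (by positivity)] at h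
    convert! h using 1
    funext k
    simp only [Function.comp_apply]
    rw [squeezedCoeff_diag, div_pow, mul_pow, Real.sq_sqrt (by positivity), add_comm k n,
      Nat.choose_symm_add]
    simp only [div_pow, one_pow, ← pow_mul]
    field_simp
    ring

/-- The two-mode squeezed state `S(t) |n, 0⟩`. -/
def squeezedFock (n : ℕ) (t : ℝ) : TwoMode :=
  ⟨fun p => (squeezedCoeff n t p : ℂ), (memlp_two_iff _).2 (by
    simpa using (hasSum_squeezedCoeff_sq n t).summable)⟩

theorem squeezedFock_apply (n : ℕ) (t : ℝ) (p : ℕ × ℕ) :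
    squeezedFock n t p = (squeezedCoeff n t p : ℂ) := rfl

theorem norm_squeezedFock (n : ℕ) (t : ℝ) : ‖squeezedFock n t‖ = 1 := by
  have h : ‖squeezedFock n t‖ ^ 2 = 1 := by
    rw [lp_norm_sq, ← (hasSum_squeezedCoeff_sq n t).tsum_eq]
    simp [squeezedFock_apply]
  exact (pow_eq_one_iff_of_nonneg (norm_nonneg _) two_ne_zero).1 h

theorem squeezedFock_zero (n : ℕ) : squeezedFock n 0 = tmul (fock n) (fock 0) := by
  ext ⟨m, k⟩
  rw [squeezedFock_apply, tmul_apply, fock, fock, lp.single_apply, lp.single_apply]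
  rcases k with _ | k
  · rcases eq_or_ne m n with rfl | h
    · simp [squeezedCoeff]
    · simp [squeezedCoeff, h]
  · simp [squeezedCoeff]

theorem sqrt_succ_mul_sqrt_choose (N k : ℕ) :
    √((N : ℝ) + 1) * √(N.choose k : ℝ) =
      √((N + 1).choose (k + 1) : ℝ) * √((k : ℝ) + 1) := by
  rw [← Real.sqrt_mul (by positivity), ← Real.sqrt_mul (by positivity)]
  congr 1
  exact_mod_cast Nat.add_one_mul_choose_eq N k

/-- The two terms in the derivative of `sinh^k / cosh^(n+k+1)` are the two neighbours on the
diagonal; the square roots match by `(N+1) choose N k = (k+1) choose (N+1) (k+1)`. -/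
theorem hasDerivAt_squeezedCoeff (n : ℕ) (p : ℕ × ℕ) (t : ℝ) :
    HasDerivAt (fun s => squeezedCoeff n s p)
      (√(p.1 : ℝ) * √(p.2 : ℝ) * squeezedCoeff n t (p.1 - 1, p.2 - 1) -
        √((p.1 : ℝ) + 1) * √((p.2 : ℝ) + 1) * squeezedCoeff n t (p.1 + 1, p.2 + 1)) t := by
  obtain ⟨m, k⟩ := p
  rcases eq_or_ne m (n + k) with rfl | h
  · simp only [squeezedCoeff_diag]
    have hc := (Real.cosh_pos t).ne'
    have hd := (((Real.hasDerivAt_sinh t).pow k).const_mul √((n + k).choose k : ℝ)).div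
      ((Real.hasDerivAt_cosh t).pow (n + k + 1)) (pow_ne_zero _ hc)
    refine hd.congr_deriv ?_
    have h1 := sqrt_succ_mul_sqrt_choose (n + k) k
    have h2 : √(((n + k : ℕ) : ℝ) + 1) * √(((n + k : ℕ) : ℝ) + 1) = ((n + k : ℕ) : ℝ) + 1 :=
      Real.mul_self_sqrt (by positivity)
    have h3 : squeezedCoeff n t (n + k + 1, k + 1) = √((n + k + 1).choose (k + 1) : ℝ) *
        Real.sinh t ^ (k + 1) / Real.cosh t ^ (n + k + 1 + 1) := squeezedCoeff_diag n (k + 1) t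
    have h4 : √(((n + k : ℕ) : ℝ) + 1) * √((k : ℝ) + 1) * √((n + k + 1).choose (k + 1) : ℝ) =
        ((n + k : ℕ) + 1) * √((n + k).choose k : ℝ) := by
      linear_combination (-√(((n + k : ℕ) : ℝ) + 1)) * h1 + √((n + k).choose k : ℝ) * h2
    have h5 : √(((n + k : ℕ) : ℝ) + 1) * √((k : ℝ) + 1) * squeezedCoeff n t (n + k + 1, k + 1) =
        ((n + k : ℕ) + 1) * √((n + k).choose k : ℝ) * Real.sinh t ^ (k + 1) /
          Real.cosh t ^ (n + k + 1 + 1) := by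
      rw [h3, ← h4]
      ring
    simp only [h5, Pi.pow_apply]
    rcases k with _ | k
    · simp
      field_simp
      ring
    · have h6 : squeezedCoeff n t (n + (k + 1) - 1, k + 1 - 1) = √((n + k).choose k : ℝ) *
        Real.sinh t ^ k / Real.cosh t ^ (n + k + 1) := squeezedCoeff_diag n k t
      have h7 := sqrt_succ_mul_sqrt_choose (n + k) k
      have h8 : √((k : ℝ) + 1) * √((k : ℝ) + 1) = (k : ℝ) + 1 := Real.mul_self_sqrt (by positivity)
      have h9 : √((n + (k + 1) : ℕ) : ℝ) * √((k + 1 : ℕ) : ℝ) * √((n + k).choose k : ℝ) =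
          ((k : ℝ) + 1) * √((n + (k + 1)).choose (k + 1) : ℝ) := by
        push_cast at h7 ⊢
        rw [← add_assoc (n : ℝ)]
        linear_combination √((k : ℝ) + 1) * h7 + √((n + (k + 1)).choose (k + 1) : ℝ) * h8
      have h10 : √((n + (k + 1) : ℕ) : ℝ) * √((k + 1 : ℕ) : ℝ) *
          squeezedCoeff n t (n + (k + 1) - 1, k + 1 - 1) =
            ((k : ℝ) + 1) * √((n + (k + 1)).choose (k + 1) : ℝ) * Real.sinh t ^ k /
              Real.cosh t ^ (n + k + 1) := by
        rw [h6, ← h9]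
        ring
      simp only [h10]
      simp only [Nat.add_sub_cancel]
      push_cast
      field_simp
      ring
  · have h0 : (fun s => squeezedCoeff n s (m, k)) = fun _ => 0 :=
      funext fun s => squeezedCoeff_of_ne h s
    have h1 : squeezedCoeff n t (m + 1, k + 1) = 0 := squeezedCoeff_of_ne (by simp; omega) t
    -- Truncated subtraction can move an off-diagonal index onto the diagonal only if `m` or `k` is
    -- `0`, and then the prefactor vanishes.
    have h2 : √(m : ℝ) * √(k : ℝ) * squeezedCoeff n t (m - 1, k - 1) = 0 := by
      rcases m with _ | m
      · simp
      rcases k with _ | k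
      · simp
      · rw [squeezedCoeff_of_ne (by simp; omega), mul_zero]
    simp only [h0, h1, h2, mul_zero, sub_zero]
    exact hasDerivAt_const t (0 : ℝ)

theorem unitaryExp_squeezing_fock (r : ℝ) (n : ℕ) :
    unitaryExp ((r : ℂ) • (createFst * createSnd - annihilateFst * annihilateSnd))
      (tmul (fock n) (fock 0)) = squeezedFock n r := by
  have h := unitaryExp_apply_of_weak (by positivity) (isAnalyticFor_squeezing r)
    (isSkew_squeezing r) (f := fun t : ℝ => squeezedFock n (t * r)) (C := 1)
    (fun t => (norm_squeezedFock n _).le) fun p t => ?_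
  · simpa [squeezedFock_zero] using h
  · rw [neg_inner_shifts (squeezing_generator_single r p)]
    have hl : HasDerivAt (fun s : ℝ => s * r) r t := by
      simpa using! (hasDerivAt_id t).mul_const r
    have hd := ((hasDerivAt_squeezedCoeff n p (t * r)).comp t hl).ofReal_comp
    refine hd.congr_deriv ?_
    simp only [squeezedFock_apply, Complex.conj_ofReal]
    push_cast
    ring

theorem squeezing_two_fock_apply (n : ℕ) (p : ℕ × ℕ) :
    squeezing 2 (tmul (fock n) (fock 0)) p =
      ((if p.1 = n + p.2 then √(p.1.choose p.2 : ℝ) / √2 ^ (p.1 + 1) else 0 : ℝ) : ℂ) := by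
  have h1 : (1 : ℝ) ≤ √2 := Real.one_le_sqrt.2 (by norm_num)
  have h2 : Real.sinh (Real.arcosh √2) = 1 := by
    rw [Real.sinh_arcosh h1, Real.sq_sqrt (by norm_num)]
    norm_num
  rw [squeezing, unitaryExp_squeezing_fock, squeezedFock_apply, squeezedCoeff, h2,
    Real.cosh_arcosh h1, one_pow, mul_one]

/-! ### Hilbert–Schmidt operators and orthonormal bases -/

section HilbertSchmidt

variable {H H' : Type*} [NormedAddCommGroup H] [InnerProductSpace ℂ H]
  [NormedAddCommGroup H'] [InnerProductSpace ℂ H']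

theorem hasSum_norm_sq_inner_hilbertBasis (b : HilbertBasis ℕ ℂ H) (x : H) :
    HasSum (fun k => ‖inner ℂ (b k) x‖ ^ 2) (‖x‖ ^ 2) := by
  have h := (lp_summable_sq (b.repr x)).hasSum
  rw [← lp_norm_sq, b.repr.norm_map] at h
  simpa only [b.repr_apply_apply] using h

variable [CompleteSpace H] [CompleteSpace H']

/-- Parseval on both sides and Tonelli in `ENNReal`. The right side does not involve `b`, so the
Hilbert–Schmidt sum is independent of the basis. -/
theorem tsum_norm_sq_eq_adjoint (A : H →L[ℂ] H') (b : HilbertBasis ℕ ℂ H)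
    (c : HilbertBasis ℕ ℂ H') :
    ∑' k, ENNReal.ofReal (‖A (b k)‖ ^ 2) =
      ∑' n, ENNReal.ofReal (‖ContinuousLinearMap.adjoint A (c n)‖ ^ 2) := by
  have hA (k : ℕ) : ENNReal.ofReal (‖A (b k)‖ ^ 2) =
      ∑' n, ENNReal.ofReal (‖inner ℂ (c n) (A (b k))‖ ^ 2) := by
    have h := hasSum_norm_sq_inner_hilbertBasis c (A (b k))
    rw [← h.tsum_eq, ENNReal.ofReal_tsum_of_nonneg (fun _ => by positivity) h.summable]
  have hA' (n : ℕ) : ENNReal.ofReal (‖ContinuousLinearMap.adjoint A (c n)‖ ^ 2) =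
      ∑' k, ENNReal.ofReal (‖inner ℂ (c n) (A (b k))‖ ^ 2) := by
    have h := hasSum_norm_sq_inner_hilbertBasis b (ContinuousLinearMap.adjoint A (c n))
    rw [← h.tsum_eq, ENNReal.ofReal_tsum_of_nonneg (fun _ => by positivity) h.summable]
    refine tsum_congr fun k => ?_
    rw [ContinuousLinearMap.adjoint_inner_right, norm_inner_symm]
  rw [tsum_congr hA, tsum_congr hA', ENNReal.tsum_comm]

theorem hasSum_norm_sq_of_hilbertBasis {A : H →L[ℂ] H'} {s : ℝ} (b b' : HilbertBasis ℕ ℂ H)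
    (c : HilbertBasis ℕ ℂ H') (h : HasSum (fun k => ‖A (b k)‖ ^ 2) s) :
    HasSum (fun k => ‖A (b' k)‖ ^ 2) s := by
  have h1 : ∑' k, ENNReal.ofReal (‖A (b' k)‖ ^ 2) = ENNReal.ofReal s := by
    rw [tsum_norm_sq_eq_adjoint A b' c, ← tsum_norm_sq_eq_adjoint A b c, ← h.tsum_eq,
      ENNReal.ofReal_tsum_of_nonneg (fun _ => by positivity) h.summable]
  have h2 := ENNReal.hasSum_toReal (h1 ▸ ENNReal.ofReal_ne_top)
  rw [← ENNReal.tsum_toReal_eq fun _ => ENNReal.ofReal_ne_top, h1,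
    ENNReal.toReal_ofReal (h.nonneg fun _ => by positivity)] at h2
  simpa [ENNReal.toReal_ofReal] using h2

/-- Polarization writes each term through `‖(A + z B) (b k)‖²` with `z = ±1, ±i`, and these four
Hilbert–Schmidt sums do not depend on the basis. -/
theorem hasSum_inner_of_hilbertBasis {A B : H →L[ℂ] H'} {s : ℂ} (b b' : HilbertBasis ℕ ℂ H)
    (c : HilbertBasis ℕ ℂ H') (hA : Summable fun k => ‖A (b k)‖ ^ 2)
    (hB : Summable fun k => ‖B (b k)‖ ^ 2)
    (h : HasSum (fun k => inner ℂ (A (b k)) (B (b k))) s) :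
    HasSum (fun k => inner ℂ (A (b' k)) (B (b' k))) s := by
  have hC (z : ℂ) : Summable fun k => ‖(A + z • B) (b k)‖ ^ 2 := by
    refine ((hA.mul_left 2).add (hB.mul_left (2 * ‖z‖ ^ 2))).of_nonneg_of_le
      (fun _ => by positivity) fun k => ?_
    have h1 : ‖(A + z • B) (b k)‖ ≤ ‖A (b k)‖ + ‖z‖ * ‖B (b k)‖ := by
      rw [← norm_smul]
      exact norm_add_le _ _
    have h2 := mul_self_le_mul_self (norm_nonneg _) h1
    nlinarith [sq_nonneg (‖A (b k)‖ - ‖z‖ * ‖B (b k)‖)]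
  have hpol (d : HilbertBasis ℕ ℂ H) (hd : ∀ z : ℂ, HasSum (fun k => ‖(A + z • B) (d k)‖ ^ 2)
      (∑' k, ‖(A + z • B) (b k)‖ ^ 2)) :
      HasSum (fun k => inner ℂ (A (d k)) (B (d k)))
        ((((∑' k, ‖(A + (1 : ℂ) • B) (b k)‖ ^ 2 : ℝ) : ℂ) -
          ((∑' k, ‖(A + (-1 : ℂ) • B) (b k)‖ ^ 2 : ℝ) : ℂ) +
          (((∑' k, ‖(A + (-Complex.I) • B) (b k)‖ ^ 2 : ℝ) : ℂ) -
          ((∑' k, ‖(A + Complex.I • B) (b k)‖ ^ 2 : ℝ) : ℂ)) * Complex.I) / 4) := by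
    have hz (z : ℂ) := Complex.hasSum_ofReal.2 (hd z)
    refine ((((hz 1).sub (hz (-1))).add
      (((hz (-Complex.I)).sub (hz Complex.I)).mul_right Complex.I)).div_const 4).congr_fun
        fun k => ?_
    rw [inner_eq_sum_norm_sq_div_four]
    simp [sub_eq_add_neg]
  rw [h.unique (hpol b fun z => (hC z).hasSum)]
  exact hpol b' fun z => hasSum_norm_sq_of_hilbertBasis b b' c (hC z).hasSum

end HilbertSchmidt

theorem fockBasis_apply (n : ℕ) : fockBasis n = fock n :=
  (fockBasis.repr_symm_single n).symm

/-! ### The amplifier -/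

/-- The bounded linear map `y ↦ x ⊗ y` from the second mode to the pair of modes. -/
def tmulLeft (x : Mode) : Mode →L[ℂ] TwoMode :=
  LinearMap.mkContinuous
    { toFun := fun y => tmul x y
      map_add' := fun y y' => by
        ext p
        exact mul_add (x p.1) (y p.2) (y' p.2)
      map_smul' := fun c y => by
        ext p
        exact mul_left_comm (x p.1) c (y p.2) }
    ‖x‖ fun y => (norm_tmul x y).le

@[simp] theorem tmulLeft_apply (x y : Mode) : tmulLeft x y = tmul x y := rfl

/-- The isometry `x ↦ S₁₂(2) (x ⊗ |0⟩)`. -/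
def ampIsometry : Mode →L[ℂ] TwoMode := squeezing 2 ∘L tmulRight (fock 0)

theorem adjoint_ampIsometry_apply (x : Mode) (k n : ℕ) :
    ContinuousLinearMap.adjoint ampIsometry (tmul x (fock k)) n =
      ((√((n + k).choose k : ℝ) / √2 ^ (n + k + 1) : ℝ) : ℂ) * x (n + k) := by
  rw [← inner_single_one, ContinuousLinearMap.adjoint_inner_right, lp.inner_eq_tsum,
    tsum_eq_single (n + k, k)]
  · change inner ℂ (squeezing 2 (tmul (fock n) (fock 0)) (n + k, k)) _ = _
    rw [squeezing_two_fock_apply, if_pos rfl, RCLike.inner_apply, tmul_apply, Complex.conj_ofReal,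
      fock, lp.single_apply]
    simp [mul_comm]
  · intro p hp
    change inner ℂ (squeezing 2 (tmul (fock n) (fock 0)) p) _ = _
    rw [squeezing_two_fock_apply, RCLike.inner_apply, tmul_apply, Complex.conj_ofReal, fock,
      lp.single_apply]
    rcases eq_or_ne p.2 k with h | h
    · rw [if_neg fun h' => hp (Prod.ext (by rw [h', h]) h)]
      simp
    · simp [h]

/-- For fixed `m = n + k` the squared weights `choose m k / 2^(m+1)` sum to `1/2`. This
Hilbert–Schmidt bound gives `A_2(X)` a meaning for every bounded `X`. -/
theorem hasSum_norm_sq_adjoint_ampIsometry (x : Mode) :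
    HasSum (fun k => ‖ContinuousLinearMap.adjoint ampIsometry (tmul x (fock k))‖ ^ 2)
      (‖x‖ ^ 2 / 2) := by
  set F : ℕ × ℕ → ℝ := fun p =>
    ‖ContinuousLinearMap.adjoint ampIsometry (tmul x (fock p.1)) p.2‖ ^ 2 with hF
  have hanti (m : ℕ) : ∑ p ∈ antidiagonal m, F p = ‖x m‖ ^ 2 / 2 := by
    have h1 : ∀ p ∈ antidiagonal m, F p = (m.choose p.1 : ℝ) * (‖x m‖ ^ 2 / 2 ^ (m + 1)) := by
      intro p hp
      rw [← Finset.HasAntidiagonal.mem_antidiagonal.1 hp, hF]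
      simp only [adjoint_ampIsometry_apply]
      rw [norm_mul, mul_pow, Complex.norm_real, norm_div, div_pow, norm_pow,
        Real.norm_of_nonneg (Real.sqrt_nonneg _), Real.norm_of_nonneg (Real.sqrt_nonneg _),
        Real.sq_sqrt (by positivity), ← pow_mul, mul_comm _ 2, pow_mul,
        Real.sq_sqrt (by norm_num), add_comm p.2 p.1]
      ring
    rw [Finset.sum_congr rfl h1, ← Finset.sum_mul,
      Finset.Nat.sum_antidiagonal_eq_sum_range_succ_mk, ← Nat.cast_sum, Nat.sum_range_choose]
    push_cast
    field_simp
    ring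
  have hsum : Summable F := by
    rw [summable_prod_iff_antidiagonal fun _ => by positivity]
    simp only [hanti]
    exact (lp_summable_sq x).div_const 2
  have htot : HasSum F (‖x‖ ^ 2 / 2) := by
    have h := hsum.hasSum
    rw [tsum_prod_eq_tsum_antidiagonal hsum] at h
    simp only [hanti] at h
    rwa [tsum_div_const, ← lp_norm_sq] at h
  refine htot.prod_fiberwise fun k => ?_
  have h := (lp_summable_sq (ContinuousLinearMap.adjoint ampIsometry (tmul x (fock k)))).hasSum
  rwa [← lp_norm_sq] at h

theorem memlp_two_of_summable {f : ℕ → Mode} (h : Summable fun k => ‖f k‖ ^ 2) : Memℓp f 2 := by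
  rw [memℓp_gen_iff (by norm_num)]
  simpa using h

theorem summable_norm_sq_ampColumns (A : Mode →L[ℂ] Mode) (y : Mode) :
    Summable fun k =>
      ‖A (ContinuousLinearMap.adjoint ampIsometry (tmul y (fock k)))‖ ^ 2 := by
  refine ((hasSum_norm_sq_adjoint_ampIsometry y).summable.mul_left (‖A‖ ^ 2)).of_nonneg_of_le
    (fun _ => by positivity) fun k => ?_
  rw [← mul_pow]
  gcongr
  exact A.le_opNorm _

/-- The operator `y ↦ ⨁ₖ A W† (y ⊗ |k⟩)`, where `W` is the amplifier isometry. -/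
def ampColumns (A : Mode →L[ℂ] Mode) : Mode →L[ℂ] lp (fun _ : ℕ => Mode) 2 :=
  LinearMap.mkContinuous
    { toFun := fun y => ⟨fun k => A (ContinuousLinearMap.adjoint ampIsometry (tmul y (fock k))),
        memlp_two_of_summable (summable_norm_sq_ampColumns A y)⟩
      map_add' := fun y y' => by
        ext1
        funext k
        change A (ContinuousLinearMap.adjoint ampIsometry (tmulRight (fock k) (y + y'))) =
          A (ContinuousLinearMap.adjoint ampIsometry (tmulRight (fock k) y)) +
          A (ContinuousLinearMap.adjoint ampIsometry (tmulRight (fock k) y'))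
        simp only [map_add]
      map_smul' := fun c y => by
        ext1
        funext k
        change A (ContinuousLinearMap.adjoint ampIsometry (tmulRight (fock k) (c • y))) =
          c • A (ContinuousLinearMap.adjoint ampIsometry (tmulRight (fock k) y))
        simp only [map_smul] }
    ‖A‖ fun y => by
      refine le_of_sq_le_sq ?_ (by positivity)
      have h := lp.norm_rpow_eq_tsum (p := 2) (by norm_num) (⟨fun k => A (ContinuousLinearMap.adjoint
        ampIsometry (tmul y (fock k))), memlp_two_of_summable (summable_norm_sq_ampColumns A y)⟩ :
          lp (fun _ : ℕ => Mode) 2)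
      simp only [ENNReal.toReal_ofNat, Real.rpow_ofNat] at h
      change ‖(⟨fun k => A (ContinuousLinearMap.adjoint ampIsometry (tmul y (fock k))),
        memlp_two_of_summable (summable_norm_sq_ampColumns A y)⟩ :
          lp (fun _ : ℕ => Mode) 2)‖ ^ 2 ≤ _
      rw [h]
      have h2 := (hasSum_norm_sq_adjoint_ampIsometry y).mul_left (‖A‖ ^ 2)
      refine (Summable.tsum_le_tsum (fun k => ?_) (summable_norm_sq_ampColumns A y)
        h2.summable).trans ?_
      · rw [← mul_pow]
        gcongr
        exact A.le_opNorm _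
      · rw [h2.tsum_eq, mul_pow]
        gcongr
        linarith [sq_nonneg ‖y‖]

/-- The operator `∑ₖ Kₖ X Kₖ†`, where `Kₖ† = W† (· ⊗ |k⟩)`. -/
def ampOutput (X : Mode →L[ℂ] Mode) : Mode →L[ℂ] Mode :=
  ContinuousLinearMap.adjoint (ampColumns 1) ∘L ampColumns X

theorem hasSum_ampOutput (X : Mode →L[ℂ] Mode) (x y : Mode) :
    HasSum (fun k => inner ℂ (ContinuousLinearMap.adjoint ampIsometry (tmul x (fock k)))
      (X (ContinuousLinearMap.adjoint ampIsometry (tmul y (fock k)))))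
      (inner ℂ x (ampOutput X y)) := by
  rw [ampOutput, ContinuousLinearMap.comp_apply, ContinuousLinearMap.adjoint_inner_right]
  exact lp.hasSum_inner (𝕜 := ℂ) (ampColumns 1 x) (ampColumns X y)

/-- Each matrix element is `⟨W†(x ⊗ bₖ), X W†(y ⊗ bₖ)⟩`, a pairing of two Hilbert–Schmidt operators
at `bₖ`, so the Fock basis suffices. -/
theorem isPartialTrace_ampOutput (X : Mode →L[ℂ] Mode) :
    IsPartialTrace (squeezing 2 ∘L tensorVacuum X ∘L ContinuousLinearMap.adjoint (squeezing 2))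
      (ampOutput X) := by
  intro b x y
  have h := hasSum_inner_of_hilbertBasis
    (A := ContinuousLinearMap.adjoint ampIsometry ∘L tmulLeft x)
    (B := X ∘L ContinuousLinearMap.adjoint ampIsometry ∘L tmulLeft y) fockBasis b fockBasis
    (by simpa only [fockBasis_apply] using! (hasSum_norm_sq_adjoint_ampIsometry x).summable)
    (by simpa only [fockBasis_apply] using! summable_norm_sq_ampColumns X y)
    (by simpa only [fockBasis_apply] using! hasSum_ampOutput X x y)
  refine h.congr_fun fun k => ?_
  simp only [ContinuousLinearMap.comp_apply, tmulLeft_apply, tensorVacuum,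
    ContinuousLinearMap.adjoint_inner_left, ampIsometry, ContinuousLinearMap.adjoint_comp]

theorem amplifier_two (X : Mode →L[ℂ] Mode) : amplifier 2 X = ampOutput X := by
  have h : ∃ T, IsPartialTrace
      (squeezing 2 ∘L tensorVacuum X ∘L ContinuousLinearMap.adjoint (squeezing 2)) T :=
    ⟨_, isPartialTrace_ampOutput X⟩
  rw [amplifier, partialTrace, dif_pos h]
  exact h.choose_spec.unique (isPartialTrace_ampOutput X)

/-- The binomial weight splits `√((n+k)!)` into `√(n!) √(k!)`, so each adjoint Kraus operator merely
rescales the exponential vector. -/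
theorem adjoint_ampIsometry_expVec (w : ℂ) (k : ℕ) :
    ContinuousLinearMap.adjoint ampIsometry (tmul (expVec w) (fock k)) =
      ((√2 : ℝ) : ℂ)⁻¹ • (expVec (w / (√2 : ℝ)) k • expVec (w / (√2 : ℝ))) := by
  ext n
  rw [adjoint_ampIsometry_apply]
  change _ = ((√2 : ℝ) : ℂ)⁻¹ * (expVec (w / (√2 : ℝ)) k * expVec (w / (√2 : ℝ)) n)
  have h : √((n + k).choose k : ℝ) * (√(k ! : ℝ) * √(n ! : ℝ)) = √((n + k)! : ℝ) := by
    rw [← Real.sqrt_mul (by positivity), ← Real.sqrt_mul (by positivity)]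
    congr 1
    rw [mul_comm (k ! : ℝ), ← mul_assoc]
    exact_mod_cast Nat.add_choose_mul_factorial_mul_factorial n k
  have h0 : √((n + k)! : ℝ) ≠ 0 := by positivity
  have hk : √(k ! : ℝ) ≠ 0 := by positivity
  have hn : √(n ! : ℝ) ≠ 0 := by positivity
  have h2 : √(2 : ℝ) ≠ 0 := by positivity
  rw [expVec_apply, expVec_apply, expVec_apply]
  have hreal : √((n + k).choose k : ℝ) / √2 ^ (n + k + 1) / √((n + k)! : ℝ) =
      (√2)⁻¹ * ((√2 ^ k)⁻¹ / √(k ! : ℝ) * ((√2 ^ n)⁻¹ / √(n ! : ℝ))) := by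
    rw [div_div, div_eq_iff (by positivity), ← h]
    field_simp
    ring
  have hC := congrArg (Complex.ofReal) hreal
  push_cast at hC ⊢
  linear_combination w ^ (n + k) * hC

/-- The scalars left by `adjoint_ampIsometry_expVec` sum over `k` to `⟨e_{z/√2}, e_{w/√2}⟩ =
exp(z̄w/2)`. -/
theorem inner_expVec_amplifier (X : Mode →L[ℂ] Mode) (z w : ℂ) :
    inner ℂ (expVec z) (amplifier 2 X (expVec w)) = 2⁻¹ * (Complex.exp (conj z * w / 2) *
      inner ℂ (expVec (z / (√2 : ℝ))) (X (expVec (w / (√2 : ℝ))))) := by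
  rw [amplifier_two]
  refine (hasSum_ampOutput X (expVec z) (expVec w)).unique ?_
  have h2 : ((√2 : ℝ) : ℂ) * ((√2 : ℝ) : ℂ) = 2 := by
    rw [← Complex.ofReal_mul, Real.mul_self_sqrt (by norm_num)]
    simp
  have h := ((lp.hasSum_inner (𝕜 := ℂ) (expVec (z / (√2 : ℝ))) (expVec (w / (√2 : ℝ)))).mul_right
    (inner ℂ (expVec (z / (√2 : ℝ))) (X (expVec (w / (√2 : ℝ)))))).mul_left (2 : ℂ)⁻¹
  rw [inner_expVec_expVec, map_div₀, Complex.conj_ofReal, div_mul_div_comm, h2] at h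
  refine h.congr_fun fun k => ?_
  rw [adjoint_ampIsometry_expVec, adjoint_ampIsometry_expVec]
  simp only [map_smul, inner_smul_left, inner_smul_right, RCLike.inner_apply, map_inv₀,
    Complex.conj_ofReal]
  rw [← h2, mul_inv]
  ring

/-! ### Totality of the exponential vectors -/

/-- `z ↦ ⟨e_{z̄}, x⟩` is a power series with coefficients `x n / √(n!)`, and a vanishing power
series has zero coefficients. -/
theorem eq_zero_of_inner_expVec {x : Mode} (h : ∀ z, inner ℂ (expVec z) x = 0) : x = 0 := by
  set c : ℕ → ℂ := fun n => x n / (√(n ! : ℝ) : ℝ)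
  have hp : HasFPowerSeriesAt 0 (FormalMultilinearSeries.ofScalars ℂ c) (0 : ℂ) := by
    rw [hasFPowerSeriesAt_iff]
    refine Filter.Eventually.of_forall fun z => ?_
    have hs := lp.hasSum_inner (𝕜 := ℂ) (expVec (conj z)) x
    rw [h] at hs
    refine hs.congr_fun fun n => ?_
    rw [FormalMultilinearSeries.coeff_ofScalars, RCLike.inner_apply, expVec_apply, map_div₀,
      map_pow, Complex.conj_conj, Complex.conj_ofReal, smul_eq_mul]
    ring
  ext n
  have hc : c n = 0 := by
    have h0 := FormalMultilinearSeries.coeff_ofScalars (𝕜 := ℂ) (p := c) (n := n)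
    rw [← h0, hp.eq_zero]
    rfl
  have hn : ((√(n ! : ℝ) : ℝ) : ℂ) ≠ 0 := by
    rw [Complex.ofReal_ne_zero]
    positivity
  exact (div_eq_zero_iff.1 hc).resolve_right hn

theorem ext_inner_expVec {x y : Mode} (h : ∀ z, inner ℂ (expVec z) x = inner ℂ (expVec z) y) :
    x = y :=
  sub_eq_zero.1 (eq_zero_of_inner_expVec fun z => by rw [inner_sub_right, h, sub_self])

theorem operator_ext_expVec {S T : Mode →L[ℂ] Mode}
    (h : ∀ z w, inner ℂ (expVec z) (S (expVec w)) = inner ℂ (expVec z) (T (expVec w))) :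
    S = T := by
  have h1 (w : ℂ) : S (expVec w) = T (expVec w) := ext_inner_expVec fun z => h z w
  have h2 : ContinuousLinearMap.adjoint S = ContinuousLinearMap.adjoint T := by
    ext1 v
    refine ext_inner_expVec fun w => ?_
    rw [ContinuousLinearMap.adjoint_inner_right, ContinuousLinearMap.adjoint_inner_right, h1]
  exact ContinuousLinearMap.adjoint.injective h2

/-! ### Coherent states -/

theorem inner_expVec_coherent (z β : ℂ) :
    inner ℂ (expVec z) (coherent β) = Complex.exp (-(β * conj β) / 2 + conj z * β) := by
  rw [coherent_eq_smul_expVec, inner_smul_right, inner_expVec_expVec, Complex.exp_add,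
    Complex.mul_conj, Complex.normSq_eq_norm_sq]
  push_cast
  rfl

theorem inner_expVec_coherentProj (β z w : ℂ) :
    inner ℂ (expVec z) (coherentProj β (expVec w)) =
      Complex.exp (-(β * conj β) + conj β * w + conj z * β) := by
  rw [coherentProj, InnerProductSpace.rankOne_apply, inner_smul_right, ← inner_conj_symm,
    inner_expVec_coherent, inner_expVec_coherent, ← Complex.exp_conj, ← Complex.exp_add]
  congr 1
  simp only [map_add, map_neg, map_mul, map_div₀, Complex.conj_conj, map_ofNat]
  ring

theorem inner_coherent_coherent (β γ : ℂ) :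
    inner ℂ (coherent β) (coherent γ) =
      Complex.exp (-(β * conj β) / 2 - (γ * conj γ) / 2 + conj β * γ) := by
  rw [coherent_eq_smul_expVec β, inner_smul_left, inner_expVec_coherent, Complex.conj_ofReal,
    Complex.ofReal_exp, ← Complex.exp_add, Complex.mul_conj β, Complex.normSq_eq_norm_sq]
  congr 1
  push_cast
  ring

theorem continuous_coherent : Continuous coherent := by
  refine continuous_iff_continuousAt.2 fun β => ?_
  rw [ContinuousAt, tendsto_iff_norm_sub_tendsto_zero]
  have h (γ : ℂ) : ‖coherent γ - coherent β‖ =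
      √(2 - 2 * (Complex.exp (-(γ * conj γ) / 2 - (β * conj β) / 2 + conj γ * β)).re) := by
    rw [← inner_coherent_coherent]
    refine (Real.sqrt_sq (norm_nonneg _)).symm.trans (congrArg _ ?_)
    have := norm_sub_sq (𝕜 := ℂ) (coherent γ) (coherent β)
    rw [norm_coherent, norm_coherent] at this
    simp only [RCLike.re_to_complex] at this
    linarith
  simp only [h]
  have hc : Continuous fun γ : ℂ =>
      √(2 - 2 * (Complex.exp (-(γ * conj γ) / 2 - (β * conj β) / 2 + conj γ * β)).re) := by
    fun_prop
  have h0 := hc.tendsto β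
  rw [← h β, sub_self, norm_zero] at h0
  exact h0

theorem norm_coherentProj_sub_le (β γ : ℂ) :
    ‖coherentProj β - coherentProj γ‖ ≤ 2 * ‖coherent β - coherent γ‖ := by
  have h : coherentProj β - coherentProj γ =
      InnerProductSpace.rankOne ℂ (coherent β - coherent γ) (coherent β) +
        InnerProductSpace.rankOne ℂ (coherent γ) (coherent β - coherent γ) := by
    ext1 x
    simp only [coherentProj, sub_apply, add_apply, InnerProductSpace.rankOne_apply,
      inner_sub_left]
    module
  rw [h]
  refine (norm_add_le _ _).trans (le_of_eq ?_)
  rw [InnerProductSpace.norm_rankOne, InnerProductSpace.norm_rankOne, norm_coherent,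
    norm_coherent]
  ring

theorem continuous_coherentProj : Continuous coherentProj := by
  refine continuous_iff_continuousAt.2 fun β => ?_
  rw [ContinuousAt, tendsto_iff_norm_sub_tendsto_zero]
  have h := tendsto_iff_norm_sub_tendsto_zero.1 (continuous_coherent.tendsto β)
  refine squeeze_zero (fun _ => norm_nonneg _) (fun γ => norm_coherentProj_sub_le γ β) ?_
  simpa using h.const_mul 2

theorem norm_coherentProj (β : ℂ) : ‖coherentProj β‖ = 1 := by
  rw [coherentProj, InnerProductSpace.norm_rankOne, norm_coherent, one_mul]

open MeasureTheory

theorem integrable_smul_coherentProj {μ : Measure ℂ} {g : ℂ → ℝ} (hg : Integrable g μ)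
    {ψ : ℂ → ℂ} (hψ : Continuous ψ) : Integrable (fun γ => g γ • coherentProj (ψ γ)) μ := by
  refine hg.mono (hg.aestronglyMeasurable.smul
    (continuous_coherentProj.comp hψ).aestronglyMeasurable) (Filter.Eventually.of_forall ?_)
  intro γ
  rw [norm_smul, norm_coherentProj, mul_one]

theorem inner_integral_smul_coherentProj {μ : Measure ℂ} {g : ℂ → ℝ} (hg : Integrable g μ)
    {ψ : ℂ → ℂ} (hψ : Continuous ψ) (x y : Mode) :
    inner ℂ x ((∫ γ, g γ • coherentProj (ψ γ) ∂μ) y) =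
      ∫ γ, g γ • inner ℂ x (coherentProj (ψ γ) y) ∂μ := by
  have h := integrable_smul_coherentProj hg hψ
  rw [ContinuousLinearMap.integral_apply h, ← integral_inner (h.apply_continuousLinearMap y)]
  refine integral_congr_ae (Filter.Eventually.of_forall fun γ => ?_)
  exact real_smul_inner_right _ _ _

/-! ### The attenuator on mixtures of coherent states -/

theorem tmul_smul_smul (c d : ℂ) (x y : Mode) : tmul (c • x) (d • y) = (c * d) • tmul x y := by
  ext p
  exact mul_mul_mul_comm c (x p.1) d (y p.2)

/-- At `λ = 1/2` the angle has `cos = sin = √(1/2)`; the normalizations agree as `|√2 γ|² = |γ|² +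
|-γ|²`. -/
theorem beamsplitter_half_coherent (γ : ℂ) :
    beamsplitter (1 / 2) (tmul (coherent ((√2 : ℝ) * γ)) (fock 0)) =
      tmul (coherent γ) (coherent (-γ)) := by
  have hle : √(1 / 2 : ℝ) ≤ 1 := Real.sqrt_le_one.2 (by norm_num)
  have hcos : Real.cos (Real.arccos √(1 / 2)) = √(1 / 2) :=
    Real.cos_arccos (by linarith [Real.sqrt_nonneg (1 / 2 : ℝ)]) hle
  have hsin : Real.sin (Real.arccos √(1 / 2)) = √(1 / 2) := by
    rw [Real.sin_arccos, Real.sq_sqrt (by norm_num)]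
    norm_num
  have h2 : ((√2 : ℝ) : ℂ) * γ * ((√(1 / 2) : ℝ) : ℂ) = γ := by
    rw [mul_right_comm, ← Complex.ofReal_mul, ← Real.sqrt_mul (by norm_num)]
    norm_num
  have h := unitaryExp_beamsplitter_expVec (Real.arccos √(1 / 2)) ((√2 : ℝ) * γ)
  rw [← Complex.ofReal_cos, ← Complex.ofReal_sin, hcos, hsin, h2] at h
  have h1 : tmul (coherent ((√2 : ℝ) * γ)) (fock 0) =
      (Real.exp (-‖((√2 : ℝ) : ℂ) * γ‖ ^ 2 / 2) : ℂ) •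
        tmul (expVec ((√2 : ℝ) * γ)) (fock 0) := by
    rw [coherent_eq_smul_expVec]
    exact map_smul (tmulRight (fock 0)) _ _
  rw [h1, map_smul, beamsplitter, h, coherent_eq_smul_expVec γ, coherent_eq_smul_expVec (-γ),
    tmul_smul_smul, ← Complex.ofReal_mul, ← Real.exp_add]
  congr 3
  rw [norm_neg, norm_mul, Complex.norm_real, mul_pow, Real.norm_eq_abs, sq_abs,
    Real.sq_sqrt (by norm_num)]
  ring

theorem inner_beamsplitter_coherentProj (γ : ℂ) (x y u v : Mode) :
    inner ℂ (ContinuousLinearMap.adjoint (beamsplitter (1 / 2) ∘L tmulRight (fock 0)) (tmul x u))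
      (coherentProj ((√2 : ℝ) * γ)
        (ContinuousLinearMap.adjoint (beamsplitter (1 / 2) ∘L tmulRight (fock 0)) (tmul y v))) =
      inner ℂ x (coherentProj γ y) *
        (inner ℂ u (coherent (-γ)) * inner ℂ (coherent (-γ)) v) := by
  have hW : (beamsplitter (1 / 2) ∘L tmulRight (fock 0)) (coherent ((√2 : ℝ) * γ)) =
    tmul (coherent γ) (coherent (-γ)) := beamsplitter_half_coherent γ
  rw [coherentProj, coherentProj, InnerProductSpace.rankOne_apply, InnerProductSpace.rankOne_apply,
    inner_smul_right, inner_smul_right, ContinuousLinearMap.adjoint_inner_left,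
    ContinuousLinearMap.adjoint_inner_right, hW, inner_tmul_tmul, inner_tmul_tmul]
  ring

/-- For each `γ`, tracing out `|-γ⟩` is Parseval for a unit vector. Sum and integral are exchanged
under the bound `|g γ| ‖x‖ ‖y‖ |⟨bₖ, -γ⟩|²`, whose sum over `k` is integrable. A general `μ` covers
both the Gaussian mixture and, through a Dirac mass, a single projector. -/
theorem isPartialTrace_beamsplitter_mixture {μ : Measure ℂ} {g : ℂ → ℝ} (hg : Integrable g μ) :
    IsPartialTrace (beamsplitter (1 / 2) ∘L
      tensorVacuum (∫ γ, g γ • coherentProj ((√2 : ℝ) * γ) ∂μ) ∘L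
        ContinuousLinearMap.adjoint (beamsplitter (1 / 2)))
      (∫ γ, g γ • coherentProj γ ∂μ) := by
  intro b x y
  have hψ : Continuous fun γ : ℂ => ((√2 : ℝ) : ℂ) * γ := by fun_prop
  have hout := inner_integral_smul_coherentProj hg continuous_id x y
  have hin (k : ℕ) : inner ℂ (tmul x (b k)) ((beamsplitter (1 / 2) ∘L
      tensorVacuum (∫ γ, g γ • coherentProj ((√2 : ℝ) * γ) ∂μ) ∘L
        ContinuousLinearMap.adjoint (beamsplitter (1 / 2))) (tmul y (b k))) =
      ∫ γ, g γ • (inner ℂ x (coherentProj γ y) *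
        (inner ℂ (b k) (coherent (-γ)) * inner ℂ (coherent (-γ)) (b k))) ∂μ := by
    simp only [← inner_beamsplitter_coherentProj]
    rw [← inner_integral_smul_coherentProj hg hψ]
    simp only [ContinuousLinearMap.comp_apply, tensorVacuum,
      ContinuousLinearMap.adjoint_inner_left, ContinuousLinearMap.adjoint_comp]
  simp only [id] at hout
  rw [hout]
  simp only [hin]
  have hpars (γ : ℂ) := hasSum_norm_sq_inner_hilbertBasis b (coherent (-γ))
  simp only [norm_coherent, one_pow] at hpars
  have hprod (k : ℕ) (γ : ℂ) : inner ℂ (b k) (coherent (-γ)) * inner ℂ (coherent (-γ)) (b k) =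
      ((‖inner ℂ (b k) (coherent (-γ))‖ ^ 2 : ℝ) : ℂ) := by
    rw [← inner_conj_symm (coherent (-γ)), Complex.mul_conj, Complex.normSq_eq_norm_sq]
  have hcont : Continuous fun γ => inner ℂ x (coherentProj γ y) :=
    continuous_const.inner (continuous_coherentProj.clm_apply continuous_const)
  have hcoh : Continuous fun γ : ℂ => coherent (-γ) := continuous_coherent.comp continuous_neg
  refine hasSum_integral_of_dominated_convergence
    (fun k γ => ‖g γ‖ * (‖x‖ * ‖y‖) * ‖inner ℂ (b k) (coherent (-γ))‖ ^ 2) (fun k => ?_)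
    (fun k => Filter.Eventually.of_forall fun γ => ?_)
    (Filter.Eventually.of_forall fun γ => ((hpars γ).mul_left _).summable) ?_
    (Filter.Eventually.of_forall fun γ => ?_)
  · refine hg.aestronglyMeasurable.smul (Continuous.aestronglyMeasurable ?_)
    exact hcont.mul ((continuous_const.inner hcoh).mul (hcoh.inner continuous_const))
  · rw [hprod, norm_smul, norm_mul, Complex.norm_real,
      Real.norm_of_nonneg (sq_nonneg ‖inner ℂ (b k) (coherent (-γ))‖), ← mul_assoc]
    gcongr
    refine (norm_inner_le_norm _ _).trans ?_
    gcongr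
    refine (ContinuousLinearMap.le_opNorm _ _).trans ?_
    rw [norm_coherentProj, one_mul]
  · have h : (fun γ => ∑' k, ‖g γ‖ * (‖x‖ * ‖y‖) * ‖inner ℂ (b k) (coherent (-γ))‖ ^ 2) =
        fun γ => ‖g γ‖ * (‖x‖ * ‖y‖) := by
      funext γ
      rw [((hpars γ).mul_left _).tsum_eq, mul_one]
    rw [h]
    exact hg.norm.mul_const _
  · simp only [hprod]
    have h := ((Complex.hasSum_ofReal.2 (hpars γ)).mul_left
      (inner ℂ x (coherentProj γ y))).const_smul (g γ)
    simpa using! h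

theorem attenuator_half_mixture {μ : Measure ℂ} {g : ℂ → ℝ} (hg : Integrable g μ) :
    attenuator (1 / 2) (∫ γ, g γ • coherentProj ((√2 : ℝ) * γ) ∂μ) =
      ∫ γ, g γ • coherentProj γ ∂μ := by
  have h := isPartialTrace_beamsplitter_mixture hg
  rw [attenuator, partialTrace, dif_pos ⟨_, h⟩]
  exact (Exists.choose_spec (⟨_, h⟩ : ∃ T, IsPartialTrace _ T)).unique h

theorem attenuator_half_coherentProj (γ : ℂ) :
    attenuator (1 / 2) (coherentProj ((√2 : ℝ) * γ)) = coherentProj γ := by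
  have h := attenuator_half_mixture (μ := Measure.dirac γ) (g := fun _ => 1)
    (integrable_dirac (by simp))
  simpa [integral_dirac] using h

/-! ### The amplifier on displaced parities and coherent states -/

theorem sqrt_two_mul_self : ((√2 : ℝ) : ℂ) * ((√2 : ℝ) : ℂ) = 2 := by
  rw [← Complex.ofReal_mul, Real.mul_self_sqrt (by norm_num)]
  simp

theorem div_sqrt_two (z : ℂ) : z / ((√2 : ℝ) : ℂ) = z * (√2 : ℝ) / 2 := by
  have h : ((√2 : ℝ) : ℂ) ≠ 0 := by
    rw [Complex.ofReal_ne_zero]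
    positivity
  rw [← sqrt_two_mul_self]
  field_simp

/-- The prefactor `2` of the parity cancels the amplifier's `1/2`, and the terms in `z̄w` cancel in
the exponent, leaving a product of a function of `z̄` and a function of `w`. -/
theorem amplifier_displacedParity (α : ℂ) :
    amplifier 2 (displacedParity α) = coherentProj ((√2 : ℝ) * α) := by
  refine operator_ext_expVec fun z w => ?_
  rw [inner_expVec_amplifier, displacedParity_expVec, inner_smul_right, inner_expVec_expVec,
    inner_expVec_coherentProj, mul_assoc (2 : ℂ), ← Complex.exp_add,
    mul_left_comm _ (2 : ℂ), inv_mul_cancel_left₀ two_ne_zero, ← Complex.exp_add]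
  congr 1
  simp only [div_sqrt_two, map_mul, map_div₀, Complex.conj_ofReal, map_ofNat]
  linear_combination (α * conj α - conj z * w / 4) * sqrt_two_mul_self

/-- In real coordinates the linear part has coefficients `u + v` and `i (v - u)`, whose squares add
up to `4uv`. -/
theorem integral_gaussian (u v : ℂ) :
    ∫ γ : ℂ, Complex.exp (-4 * (γ * conj γ) + conj γ * u + γ * v) =
      Real.pi / 4 * Complex.exp (u * v / 4) := by
  have h := GaussianFourier.integral_cexp_neg_mul_sum_add (b := 4) (by norm_num)
    (![u + v, Complex.I * (v - u)])
  rw [← Complex.volume_preserving_equiv_pi.integral_comp'] at h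
  have h2 : ((Fintype.card (Fin 2) : ℂ)) / 2 = 1 := by simp
  rw [h2, Complex.cpow_one] at h
  have hf (γ : ℂ) : Complex.exp (-4 * (γ * conj γ) + conj γ * u + γ * v) =
      Complex.exp (-4 * ∑ i, ((Complex.measurableEquivPi γ i : ℝ) : ℂ) ^ 2 +
        ∑ i, ![u + v, Complex.I * (v - u)] i * ((Complex.measurableEquivPi γ i : ℝ) : ℂ)) := by
    congr 1
    simp only [Complex.measurableEquivPi_apply, Fin.sum_univ_two, Matrix.cons_val_zero,
      Matrix.cons_val_one]
    have hre : (γ.re : ℂ) = (γ + conj γ) / 2 := by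
      rw [Complex.add_conj]
      push_cast
      ring
    have him : Complex.I * (γ.im : ℂ) = (γ - conj γ) / 2 := by
      rw [Complex.sub_conj]
      push_cast
      ring
    have him2 : (γ.im : ℂ) ^ 2 = -((γ - conj γ) / 2) ^ 2 := by
      rw [← him, mul_pow, Complex.I_sq]
      ring
    rw [him2, hre]
    linear_combination (-(v - u)) * him
  simp only [hf]
  refine h.trans ?_
  congr 2
  simp only [Fin.sum_univ_two, Matrix.cons_val_zero, Matrix.cons_val_one]
  linear_combination ((v - u) ^ 2 / 16) * Complex.I_sq

theorem integrable_gaussian (α : ℂ) :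
    Integrable fun γ : ℂ => Real.exp (-2 * ‖α - γ‖ ^ 2) := by
  have h := (GaussianFourier.integrable_cexp_neg_mul_sq_norm_add (b := 2) (V := ℂ) (by norm_num)
    0 0).norm.comp_sub_left α
  refine h.congr (Filter.Eventually.of_forall fun γ => ?_)
  simp only [Complex.norm_exp]
  congr 1
  simp [← Complex.ofReal_pow]

/-- The kernel of the mixture is a Gaussian integral with quadratic part `-4|γ|²`: half from the
weight, half from the normalization of `|√2 γ⟩`. The value `π/4` times `2/π` is the amplifier's
`1/2`. -/
theorem amplifier_coherentProj (α : ℂ) :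
    amplifier 2 (coherentProj α) =
      ∫ γ : ℂ, (2 / Real.pi * Real.exp (-2 * ‖α - γ‖ ^ 2)) • coherentProj ((√2 : ℝ) * γ) := by
  refine operator_ext_expVec fun z w => ?_
  rw [inner_expVec_amplifier, inner_expVec_coherentProj,
    inner_integral_smul_coherentProj ((integrable_gaussian α).const_mul _) (by fun_prop)]
  have h (γ : ℂ) : (2 / Real.pi * Real.exp (-2 * ‖α - γ‖ ^ 2)) •
      inner ℂ (expVec z) (coherentProj ((√2 : ℝ) * γ) (expVec w)) =
        (2 / Real.pi * Complex.exp (-2 * (α * conj α))) *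
          Complex.exp (-4 * (γ * conj γ) + conj γ * (2 * α + (√2 : ℝ) * w) +
            γ * (2 * conj α + (√2 : ℝ) * conj z)) := by
    rw [inner_expVec_coherentProj, Complex.real_smul]
    push_cast
    rw [mul_assoc (2 / (Real.pi : ℂ)), mul_assoc (2 / (Real.pi : ℂ)), ← Complex.exp_add,
      ← Complex.exp_add, ← Complex.ofReal_pow, ← Complex.normSq_eq_norm_sq,
      ← Complex.mul_conj]
    congr 2
    simp only [map_sub, map_mul, Complex.conj_ofReal]
    linear_combination (-(γ * conj γ)) * sqrt_two_mul_self
  simp only [h]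
  rw [integral_const_mul, integral_gaussian]
  have hπ : (Real.pi : ℂ) ≠ 0 := Complex.ofReal_ne_zero.2 Real.pi_ne_zero
  have h1 : 2 / (Real.pi : ℂ) * Complex.exp (-2 * (α * conj α)) * (Real.pi / 4 *
      Complex.exp ((2 * α + (√2 : ℝ) * w) * (2 * conj α + (√2 : ℝ) * conj z) / 4)) =
      2⁻¹ * Complex.exp (-2 * (α * conj α) +
        (2 * α + (√2 : ℝ) * w) * (2 * conj α + (√2 : ℝ) * conj z) / 4) := by
    rw [Complex.exp_add]
    field_simp
    norm_num
  rw [h1, ← Complex.exp_add]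
  congr 2
  simp only [div_sqrt_two, map_mul, map_div₀, Complex.conj_ofReal, map_ofNat]
  linear_combination (-(conj z * w / 4)) * sqrt_two_mul_self

theorem integral_gaussian_norm (α : ℂ) :
    ∫ γ : ℂ, Real.exp (-2 * ‖α - γ‖ ^ 2) = Real.pi / 2 := by
  rw [integral_sub_left_eq_self (fun γ : ℂ => Real.exp (-2 * ‖γ‖ ^ 2)),
    GaussianFourier.integral_rexp_neg_mul_sq_norm (by norm_num), Complex.finrank_real_complex]
  norm_num

end BosonicModes

end

/-! ### The two applications of the channel -/

theorem mainTheorem3 (α : ℂ) :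
    BosonicModes.channelC (BosonicModes.displacedParity α) = BosonicModes.coherentProj α ∧
    MeasureTheory.Integrable
      (fun γ : ℂ => Real.exp (-2 * ‖α - γ‖ ^ 2) • BosonicModes.coherentProj γ) ∧
    BosonicModes.channelC (BosonicModes.channelC (BosonicModes.displacedParity α)) =
      (2 / Real.pi) • ∫ γ : ℂ, Real.exp (-2 * ‖α - γ‖ ^ 2) • BosonicModes.coherentProj γ ∧
    (2 / Real.pi) * ∫ γ : ℂ, Real.exp (-2 * ‖α - γ‖ ^ 2) = 1 := by
  have h1 : BosonicModes.channelC (BosonicModes.displacedParity α) =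
      BosonicModes.coherentProj α := by
    rw [BosonicModes.channelC, Function.comp_apply, BosonicModes.amplifier_displacedParity,
      BosonicModes.attenuator_half_coherentProj]
  refine ⟨h1, BosonicModes.integrable_smul_coherentProj (BosonicModes.integrable_gaussian α)
    continuous_id, ?_, ?_⟩
  · rw [h1, BosonicModes.channelC, Function.comp_apply, BosonicModes.amplifier_coherentProj,
      BosonicModes.attenuator_half_mixture ((BosonicModes.integrable_gaussian α).const_mul _),
      ← MeasureTheory.integral_smul]
    simp only [smul_smul]
  · rw [BosonicModes.integral_gaussian_norm]
    have := Real.pi_ne_zero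
    field_simp
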